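/- **Setting.** Let $(P_m)_{m>0}$ be a family of probability laws on $\mathbb R$ such that $P_m$ has mean $m$ and finite variance. For each $m>0$ let $$\rho(m):=\frac{\mathsf E_m[S_{\tau_+}^2]}{2\,\mathsf E_m[S_{\tau_+}]},\qquad \tau_+:=\inf\{n\ge 1:S_n>0\},$$ where, under $\mathsf E_m$, $S_n$ is a random walk with i.i.d. increments of law $P_m$ (so that $S_{\tau_+}$ is its first ascending ladder height). Fix $\mu>0$, let $X,X_1,X_2,\dots$ be i.i.d. with law $P_\mu$, and put $\sigma:=\mathsf{sd}(X)$, $S_0:=0$, $S_n:=X_1+\dots+X_n$. For $\Delta>0$ and $t>0$ define $\tau_0:=0$ and $$\tau_n:=\inf\{s\ge\tau_{n-1}:S_s-S_{\tau_{n-1}}\ge\Delta\},\quad \tau:=\tau_1,\quad \delta=\delta(\Delta):=\mathsf E[\tau],\quad \eta:=S_\tau-\Delta,$$ $$N(t):=\max\{n\ge0:\tau_n\le t\},\quad \tau(t):=\tau_{N(t)},\quad \check\mu_t:=\frac{N(t)\,\Delta}{t},\quad \hat\mu_t:=\frac{N(t)\,\Delta}{\tau(t)},\quad g(x):=x\Bigl(1+\frac{\rho(x)}{\Delta}\Bigr)\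 (x>0),$$ with the conventions $g(0):=0$ and $\hat\mu_t:=0$ when $N(t)=0$. **Theorem.** Suppose that $X$ is non-lattice (that is, $\mathsf P(X\in d\mathbb Z)<1$ for every $d>0$) and that - (A1) $\mathsf E[|X|^{r+1}]<\infty$ for some real $r\ge2$; - (A2) $|\mathsf E[\eta]-\rho(\mu)|=O(\Delta^{-(r-1)})$ as $\Delta\to\infty$, for some real $r\ge2$; - (A3) $m\mapsto\rho(m)$ is Lipschitz on $(0,\infty)$. Then (i) as $\delta,t\to\infty$ so that $t^{1/4}=o(\delta)$ and $\delta=o(\sqrt t)$, $$\frac{g(\check\mu_t)-\mu}{\sigma/\sqrt t}\longrightarrow\mathcal N(0,1)\quad\text{in distribution};$$ (ii) as $\delta,t\to\infty$ so that $t^{1/4}=o(\delta)$ and $\delta=o(t)$, $$\frac{g(\hat\mu_t)-\mu}{\sigma/\sqrt t}\longrightarrow\mathcal N(0,1)\quad\text{in distribution}.$$ Here the limits are taken along any sequence (or, more generally, any countably generated filter) along which $\Delta>0$ and $t>0$ vary as indicated. -/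

import Mathlib

open MeasureTheory ProbabilityTheory Filter Asymptotics
open scoped Topology NNReal

noncomputable section

namespace LowRate

/-! Path functionals.  A path of increments is a sequence `x : ℕ → ℝ`, where `x i` is the
increment at time `i + 1`. -/

/-- The random walk `S_n = X_1 + ⋯ + X_n`, with `S_0 = 0`. -/
def walk (x : ℕ → ℝ) (n : ℕ) : ℝ := ∑ i ∈ Finset.range n, x i

/-- The sampling times `τ_0 = 0`, `τ_n = inf {t ≥ τ_{n-1} : S_t - S_{τ_{n-1}} ≥ Δ}`
(with `inf ∅ = ∞`; once some `τ_{n-1}` is infinite, so are all later ones). -/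
def samplingTime (x : ℕ → ℝ) (Δ : ℝ) : ℕ → ℕ∞
  | 0 => 0
  | n + 1 => sInf {s : ℕ∞ | ∃ k : ℕ, s = (k : ℕ∞) ∧ samplingTime x Δ n ≤ (k : ℕ∞) ∧
      Δ ≤ walk x k - walk x (samplingTime x Δ n).toNat}

/-- `N(t) = max {n : τ_n ≤ t}` for a real time `t`. -/
def samplingCount (x : ℕ → ℝ) (Δ t : ℝ) : ℕ :=
  sSup {n : ℕ | ∃ k : ℕ, samplingTime x Δ n = (k : ℕ∞) ∧ (k : ℝ) ≤ t}

/-- The most recent sampling time `τ(t) = τ_{N(t)}`. -/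
def lastSamplingTime (x : ℕ → ℝ) (Δ t : ℝ) : ℕ :=
  (samplingTime x Δ (samplingCount x Δ t)).toNat

/-- The overshoot `η = η_1 = S_{τ_1} - S_{τ_0} - Δ = S_{τ_1} - Δ`. -/
def overshoot (x : ℕ → ℝ) (Δ : ℝ) : ℝ := walk x (samplingTime x Δ 1).toNat - Δ

/-- The estimator `N(t) Δ / t`. -/
def muCheck (x : ℕ → ℝ) (Δ t : ℝ) : ℝ := samplingCount x Δ t * Δ / t

/-- The estimator `N(t) Δ / τ(t)`. -/
def muHat (x : ℕ → ℝ) (Δ t : ℝ) : ℝ := samplingCount x Δ t * Δ / lastSamplingTime x Δ t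

/-- The first ascending ladder time `τ_+ = inf {t : S_t > 0}`. -/
def ladderTime (x : ℕ → ℝ) : ℕ∞ :=
  sInf {s : ℕ∞ | ∃ k : ℕ, s = (k : ℕ∞) ∧ 0 < walk x k}

/-- The first ascending ladder height `S_{τ_+}`. -/
def ladderHeight (x : ℕ → ℝ) : ℝ := walk x (ladderTime x).toNat

/-! Distributional quantities. -/

/-- The limiting average overshoot `E[S_{τ_+}²] / (2 E[S_{τ_+}])` of a random walk whose i.i.d.
increments have law `Q`. -/
def limitingOvershoot (Q : Measure ℝ) : ℝ :=
  (∫ x, ladderHeight x ^ 2 ∂(Measure.infinitePi fun _ : ℕ => Q)) /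
    (2 * ∫ x, ladderHeight x ∂(Measure.infinitePi fun _ : ℕ => Q))

/-- A law on `ℝ` is non-lattice if it is not concentrated on `d ℤ` for any `d > 0`. -/
def IsNonLattice (Q : Measure ℝ) : Prop :=
  ∀ d : ℝ, 0 < d → ¬ ∀ᵐ x ∂Q, ∃ k : ℤ, x = k * d

/-- The overshoot correction `g(x) = x (1 + ρ(x) / Δ)`. -/
def correct (ρ : ℝ → ℝ) (Δ x : ℝ) : ℝ := x * (1 + ρ x / Δ)

variable {Ω : Type*} [MeasurableSpace Ω]

/-- The sampling period `δ = E[τ_1]`. -/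
def samplingPeriod (Pr : Measure Ω) (X : ℕ → Ω → ℝ) (Δ : ℝ) : ℝ :=
  ∫ ω, ((samplingTime (fun i => X i ω) Δ 1).toNat : ℝ) ∂Pr

/-- The expected overshoot `E[η]`. -/
def meanOvershoot (Pr : Measure Ω) (X : ℕ → Ω → ℝ) (Δ : ℝ) : ℝ :=
  ∫ ω, overshoot (fun i => X i ω) Δ ∂Pr

end LowRate

end

/-! Write `N`, `T` for the number of samples and the last sampling time by `t`, and `e = E[η]` at
level `Δ`. The identity behind both estimators is `S_T = N Δ + (sum of N overshoots)`. After
centring, `N (Δ + e) - T μ` equals `S_T - T μ` minus the centred overshoot sum, so everything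
reduces to the CLT for `S_n - n μ` at `n = ⌊t⌋` plus errors of smaller order than `√t`.

Overshoots: the path after a sampling time is a fresh copy of the original, independent of the
overshoot (`map_overshoot_nextPath`), so the overshoots are i.i.d. There are `O(t / Δ)` of them, and
finite variance gives `E[η²] = o(Δ)` (`exists_integral_overshoot_sq_le`, a Wald identity with
truncation). Their centred sum therefore has variance `o(t)`.

Last sampling time: the walk gains less than `Δ` after `T`, so `T` lies in the last `β t` steps,
over which Kolmogorov's inequality makes the centred walk move by only a small multiple of `√t`.
Replacing `T` by `t` in the denominator costs `μ (t - T) / √t`, of order `Δ / √t` up to small terms,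
whence `δ = o(√t)` in (i). Dividing by `T` avoids this cost, and `δ = o(t)` suffices in (ii).

Correction: an estimator `u` differs from `μ` by `O(1/√t + 1/Δ)`. By the Lipschitz property and
(A2), using `ρ u` for `e` costs `(√t / Δ) · O(1/√t + 1/Δ)`, which vanishes when `√t = o(Δ²)`. Wald
bounds show that `δ` and `Δ` have the same order, so this is `t^{1/4} = o(δ)`.

The fluctuation bounds are collected in the event `IsGood`; on it the estimates are deterministic,
and its complement has small probability. -/

noncomputable section

namespace LowRate

/-! ### Path combinatorics -/

/-- The path of increments after time `k`. -/
def shift (k : ℕ) (x : ℕ → ℝ) : ℕ → ℝ := fun i => x (i + k)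

@[simp] theorem shift_zero (x : ℕ → ℝ) : shift 0 x = x := rfl

theorem shift_shift (j k : ℕ) (x : ℕ → ℝ) : shift j (shift k x) = shift (k + j) x := by
  funext i
  simp only [shift]
  congr 1
  omega

@[simp] theorem walk_zero (x : ℕ → ℝ) : walk x 0 = 0 := by simp [walk]

theorem walk_succ (x : ℕ → ℝ) (n : ℕ) : walk x (n + 1) = walk x n + x n := by
  simp [walk, Finset.sum_range_succ]

theorem walk_shift (x : ℕ → ℝ) (j k : ℕ) :
    walk (shift j x) k = walk x (j + k) - walk x j := by
  simp only [walk, shift, Finset.sum_range_add]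
  simp [add_comm]

theorem sInf_coe_eq_coe_iff {p : ℕ → Prop} {k : ℕ} :
    sInf {s : ℕ∞ | ∃ k : ℕ, s = (k : ℕ∞) ∧ p k} = (k : ℕ∞) ↔ p k ∧ ∀ i < k, ¬ p i := by
  constructor
  · intro h
    have hne : {s : ℕ∞ | ∃ k : ℕ, s = (k : ℕ∞) ∧ p k}.Nonempty := by
      by_contra hc
      rw [Set.not_nonempty_iff_eq_empty.1 hc, sInf_empty] at h
      exact ENat.top_ne_natCast k h
    obtain ⟨j, hj, hp⟩ := csInf_mem hne
    rw [h, ENat.natCast_inj] at hj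
    subst hj
    refine ⟨hp, fun i hi hpi => ?_⟩
    have : (k : ℕ∞) ≤ i := h ▸ sInf_le ⟨i, rfl, hpi⟩
    exact absurd (ENat.natCast_le_natCast.1 this) (by omega)
  · rintro ⟨hp, hlt⟩
    refine le_antisymm (sInf_le ⟨k, rfl, hp⟩) (le_sInf ?_)
    rintro _ ⟨j, rfl, hj⟩
    exact ENat.natCast_le_natCast.2 (not_lt.1 fun h => hlt j h hj)

theorem samplingTime_succ_eq_coe_iff {x : ℕ → ℝ} {Δ : ℝ} {n k : ℕ} :
    samplingTime x Δ (n + 1) = k ↔ ∃ j ≤ k, samplingTime x Δ n = j ∧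
      Δ ≤ walk x k - walk x j ∧ ∀ i, j ≤ i → i < k → walk x i - walk x j < Δ := by
  rw [samplingTime, sInf_coe_eq_coe_iff]
  constructor
  · rintro ⟨⟨h1, h2⟩, h3⟩
    obtain ⟨j, hj⟩ := ENat.ne_top_iff_exists.1 (ne_top_of_le_ne_top (ENat.natCast_ne_top k) h1)
    simp only [← hj, ENat.toNat_natCast, ENat.natCast_le_natCast, not_and, not_le] at h1 h2 h3
    exact ⟨j, h1, hj.symm, h2, fun i hi hik => h3 i hik hi⟩
  · rintro ⟨j, hjk, hj, h2, h3⟩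
    simp only [hj, ENat.toNat_natCast, ENat.natCast_le_natCast, not_and, not_le]
    exact ⟨⟨hjk, h2⟩, fun i hik hi => h3 i hi hik⟩

theorem samplingTime_one_eq_coe_iff {x : ℕ → ℝ} {Δ : ℝ} {k : ℕ} :
    samplingTime x Δ 1 = k ↔ Δ ≤ walk x k ∧ ∀ i < k, walk x i < Δ := by
  rw [show (1 : ℕ) = 0 + 1 from rfl, samplingTime_succ_eq_coe_iff]
  constructor
  · rintro ⟨j, -, hj, h1, h2⟩
    rw [samplingTime] at hj
    obtain rfl : j = 0 := by exact_mod_cast hj.symm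
    exact ⟨by simpa using h1, fun i hi => by simpa using h2 i (Nat.zero_le i) hi⟩
  · rintro ⟨h1, h2⟩
    exact ⟨0, Nat.zero_le _, rfl, by simpa using h1, by simpa using h2⟩

theorem lt_samplingTime_one_iff {x : ℕ → ℝ} {Δ : ℝ} {k : ℕ} :
    (k : ℕ∞) < samplingTime x Δ 1 ↔ ∀ i ≤ k, walk x i < Δ := by
  constructor
  · intro h i hi
    by_contra hc
    push Not at hc
    have : samplingTime x Δ 1 ≤ i := sInf_le ⟨i, rfl, by simp [samplingTime],
      by simpa [samplingTime] using hc⟩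
    exact absurd (h.trans_le this) (by simpa using hi)
  · intro h
    by_contra hc
    push Not at hc
    obtain ⟨j, hj⟩ := ENat.ne_top_iff_exists.1 (ne_top_of_le_ne_top (ENat.natCast_ne_top k) hc)
    rw [← hj, ENat.natCast_le_natCast] at hc
    exact absurd (samplingTime_one_eq_coe_iff.1 hj.symm).1 (not_le.2 (h j hc))

theorem samplingTime_succ_of_shift {x : ℕ → ℝ} {Δ : ℝ} {n j k : ℕ}
    (hj : samplingTime x Δ n = j) (hk : samplingTime (shift j x) Δ 1 = k) :
    samplingTime x Δ (n + 1) = (j + k : ℕ) := by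
  rw [samplingTime_one_eq_coe_iff] at hk
  refine samplingTime_succ_eq_coe_iff.2 ⟨j, by omega, hj, ?_, fun i hi hik => ?_⟩
  · rw [← walk_shift]
    exact hk.1
  · obtain ⟨i, rfl⟩ := Nat.exists_eq_add_of_le hi
    rw [← walk_shift]
    exact hk.2 i (by omega)

/-- The path of increments after the first sampling time. -/
def nextPath (Δ : ℝ) (x : ℕ → ℝ) : ℕ → ℝ := shift (samplingTime x Δ 1).toNat x

/-- Each cycle is a first passage of the restarted path and raises the walk by `Δ` plus that path's
own overshoot; summing over cycles telescopes. -/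
theorem samplingTime_renewal {x : ℕ → ℝ} {Δ : ℝ}
    (h : ∀ i, samplingTime ((nextPath Δ)^[i] x) Δ 1 ≠ ⊤) (n : ℕ) :
    ∃ k : ℕ, samplingTime x Δ n = k ∧ (nextPath Δ)^[n] x = shift k x ∧
      walk x k = n * Δ + ∑ i ∈ Finset.range n, overshoot ((nextPath Δ)^[i] x) Δ := by
  induction n with
  | zero => exact ⟨0, rfl, by simp, by simp⟩
  | succ n ih =>
    obtain ⟨k, hk, hs, hw⟩ := ih
    obtain ⟨j, hj⟩ := ENat.ne_top_iff_exists.1 (h n)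
    have hj' : samplingTime (shift k x) Δ 1 = j := by rw [← hs, hj]
    refine ⟨k + j, samplingTime_succ_of_shift hk hj', ?_, ?_⟩
    · rw [Function.iterate_succ_apply', hs, nextPath, hj', ENat.toNat_natCast, shift_shift]
    · rw [Finset.sum_range_succ, hs, overshoot, hj', ENat.toNat_natCast, walk_shift]
      push_cast
      linarith

/-- As `Δ > 0`, every cycle takes at least one step. This bounds the set whose `sSup` defines
`samplingCount`, so that the supremum is a true maximum. -/
theorem le_samplingTime {x : ℕ → ℝ} {Δ : ℝ} (hΔ : 0 < Δ) {n k : ℕ}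
    (h : samplingTime x Δ n = k) : n ≤ k := by
  induction n generalizing k with
  | zero => omega
  | succ n ih =>
    obtain ⟨j, hjk, hj, h1, -⟩ := samplingTime_succ_eq_coe_iff.1 h
    have hne : j ≠ k := by
      rintro rfl
      linarith [sub_self (walk x j)]
    have := ih hj
    omega

theorem le_samplingCount {x : ℕ → ℝ} {Δ t : ℝ} (hΔ : 0 < Δ) {n k : ℕ}
    (h : samplingTime x Δ n = k) (hk : (k : ℝ) ≤ t) : n ≤ samplingCount x Δ t := by
  refine le_csSup ⟨⌊t⌋₊, ?_⟩ ⟨k, h, hk⟩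
  rintro m ⟨j, hj, hjt⟩
  exact (le_samplingTime hΔ hj).trans (Nat.le_floor hjt)

theorem samplingTime_samplingCount {x : ℕ → ℝ} {Δ t : ℝ} (hΔ : 0 < Δ) (ht : 0 ≤ t) :
    samplingTime x Δ (samplingCount x Δ t) = lastSamplingTime x Δ t ∧
      (lastSamplingTime x Δ t : ℝ) ≤ t := by
  have hmem : samplingCount x Δ t ∈
      {n : ℕ | ∃ k : ℕ, samplingTime x Δ n = (k : ℕ∞) ∧ (k : ℝ) ≤ t} := by
    refine Nat.sSup_mem ⟨0, 0, rfl, by simpa using ht⟩ ⟨⌊t⌋₊, ?_⟩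
    rintro m ⟨j, hj, hjt⟩
    exact (le_samplingTime hΔ hj).trans (Nat.le_floor hjt)
  obtain ⟨k, hk, hkt⟩ := hmem
  rw [lastSamplingTime, hk, ENat.toNat_natCast]
  exact ⟨rfl, hkt⟩

theorem samplingTime_mono_of_eq {x : ℕ → ℝ} {Δ : ℝ} {n m k : ℕ} (hnm : n ≤ m)
    (h : samplingTime x Δ m = k) : ∃ j ≤ k, samplingTime x Δ n = j := by
  induction m, hnm using Nat.le_induction generalizing k with
  | base => exact ⟨k, le_rfl, h⟩
  | succ m _ ih =>
    obtain ⟨j, hjk, hj, -⟩ := samplingTime_succ_eq_coe_iff.1 h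
    obtain ⟨i, hij, hi⟩ := ih hj
    exact ⟨i, hij.trans hjk, hi⟩

theorem le_samplingCount_iff {x : ℕ → ℝ} {Δ t : ℝ} (hΔ : 0 < Δ) (ht : 0 ≤ t) {n : ℕ} :
    n ≤ samplingCount x Δ t ↔ ∃ k : ℕ, samplingTime x Δ n = k ∧ (k : ℝ) ≤ t := by
  constructor
  · intro h
    obtain ⟨h1, h2⟩ := samplingTime_samplingCount (x := x) hΔ ht
    obtain ⟨j, hj, hj'⟩ := samplingTime_mono_of_eq h h1
    exact ⟨j, hj', le_trans (by exact_mod_cast hj) h2⟩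
  · rintro ⟨k, hk, hkt⟩
    exact le_samplingCount hΔ hk hkt

theorem walk_sub_walk_lastSamplingTime_lt {x : ℕ → ℝ} {Δ t : ℝ} (hΔ : 0 < Δ) (ht : 0 ≤ t)
    {k : ℕ} (h1 : lastSamplingTime x Δ t ≤ k) (h2 : (k : ℝ) ≤ t) :
    walk x k - walk x (lastSamplingTime x Δ t) < Δ := by
  by_contra hc
  push Not at hc
  obtain ⟨hT, -⟩ := samplingTime_samplingCount (x := x) hΔ ht
  have hle : samplingTime x Δ (samplingCount x Δ t + 1) ≤ k :=
    sInf_le ⟨k, rfl, by rw [hT]; exact_mod_cast h1, by rwa [hT, ENat.toNat_natCast]⟩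
  obtain ⟨j, hj⟩ := ENat.ne_top_iff_exists.1 (ne_top_of_le_ne_top (ENat.natCast_ne_top k) hle)
  rw [← hj, ENat.natCast_le_natCast] at hle
  have := le_samplingCount hΔ hj.symm (le_trans (by exact_mod_cast hle) h2)
  omega

theorem overshoot_nonneg {x : ℕ → ℝ} {Δ : ℝ} (h : samplingTime x Δ 1 ≠ ⊤) :
    0 ≤ overshoot x Δ := by
  obtain ⟨k, hk⟩ := ENat.ne_top_iff_exists.1 h
  rw [overshoot, ← hk, ENat.toNat_natCast, sub_nonneg]
  exact (samplingTime_one_eq_coe_iff.1 hk.symm).1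

/-- One step before the crossing the walk is still below `Δ`, so the crossing increment dominates
the overshoot. -/
theorem overshoot_le_increment {x : ℕ → ℝ} {Δ : ℝ} (hΔ : 0 < Δ) {k : ℕ}
    (h : samplingTime x Δ 1 = k) : ∃ j, k = j + 1 ∧ overshoot x Δ ≤ x j := by
  obtain ⟨h1, h2⟩ := samplingTime_one_eq_coe_iff.1 h
  cases k with
  | zero => simp at h1; linarith
  | succ j =>
    refine ⟨j, rfl, ?_⟩
    rw [overshoot, h, ENat.toNat_natCast, walk_succ]
    linarith [h2 j (by omega)]

/-! ### Measurability of path functionals -/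

@[fun_prop]
theorem measurable_walk (n : ℕ) : Measurable fun x : ℕ → ℝ => walk x n := by
  unfold walk
  fun_prop

@[fun_prop]
theorem measurable_shift (k : ℕ) : Measurable (shift k) := by
  unfold shift
  fun_prop

theorem measurableSet_samplingTime_eq (Δ : ℝ) (n k : ℕ) :
    MeasurableSet {x | samplingTime x Δ n = k} := by
  induction n generalizing k with
  | zero => simp [samplingTime]
  | succ n ih =>
    simp only [samplingTime_succ_eq_coe_iff]
    refine MeasurableSet.congr (s := ⋃ j, ⋃ _ : j ≤ k, {x | samplingTime x Δ n = j} ∩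
      ({x | Δ ≤ walk x k - walk x j} ∩
        ⋂ i, ⋂ _ : j ≤ i, ⋂ _ : i < k, {x | walk x i - walk x j < Δ})) ?_ ?_
    · refine .iUnion fun j => .iUnion fun _ => (ih j).inter (.inter ?_ ?_)
      · exact measurableSet_le (by fun_prop) (by fun_prop)
      · refine .iInter fun i => .iInter fun _ => .iInter fun _ => ?_
        exact measurableSet_lt (by fun_prop) (by fun_prop)
    · ext x
      simp only [Set.mem_iUnion, Set.mem_inter_iff, Set.mem_ofPred_eq, Set.mem_iInter]
      exact ⟨fun ⟨j, hj, h⟩ => ⟨j, hj, h.1, h.2⟩, fun ⟨j, hj, h⟩ => ⟨j, hj, h.1, h.2⟩⟩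

theorem measurable_samplingTime_toNat (Δ : ℝ) (n : ℕ) :
    Measurable fun x => (samplingTime x Δ n).toNat := by
  refine measurable_to_countable' fun k => ?_
  have htop : MeasurableSet {x | samplingTime x Δ n = ⊤} := by
    have : {x | samplingTime x Δ n = ⊤} = (⋃ k : ℕ, {x | samplingTime x Δ n = k})ᶜ := by
      ext x
      simp only [Set.mem_ofPred_eq, Set.mem_compl_iff, Set.mem_iUnion, not_exists]
      exact ⟨fun h k => by simp [h], fun h => by
        by_contra hc
        obtain ⟨k, hk⟩ := ENat.ne_top_iff_exists.1 hc
        exact h k hk.symm⟩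
    rw [this]
    exact (MeasurableSet.iUnion fun k => measurableSet_samplingTime_eq Δ n k).compl
  -- `toNat` sends `⊤` to `0`, so the fibre over `0` also contains the paths with infinite sampling
  -- time.
  have : (fun x => (samplingTime x Δ n).toNat) ⁻¹' {k} =
      {x | samplingTime x Δ n = k} ∪ ({x | samplingTime x Δ n = ⊤} ∩ {_x | k = 0}) := by
    ext x
    simp only [Set.mem_preimage, Set.mem_singleton_iff, Set.mem_union, Set.mem_inter_iff,
      Set.mem_ofPred_eq]
    cases hx : samplingTime x Δ n with
    | top => simp [eq_comm]
    | coe j => simp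
  rw [this]
  exact (measurableSet_samplingTime_eq Δ n k).union (htop.inter (.const _))

theorem measurable_samplingCount {Δ t : ℝ} (hΔ : 0 < Δ) (ht : 0 ≤ t) :
    Measurable fun x => samplingCount x Δ t := by
  refine measurable_of_Ici fun n => ?_
  have : (fun x => samplingCount x Δ t) ⁻¹' Set.Ici n =
      ⋃ k : ℕ, {x | samplingTime x Δ n = k} ∩ {_x | (k : ℝ) ≤ t} := by
    ext x
    simp [le_samplingCount_iff hΔ ht]
  rw [this]
  exact .iUnion fun k => (measurableSet_samplingTime_eq Δ n k).inter (.const _)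

theorem measurable_lastSamplingTime {Δ t : ℝ} (hΔ : 0 < Δ) (ht : 0 ≤ t) :
    Measurable fun x => lastSamplingTime x Δ t := by
  have h : Measurable fun p : ℕ × (ℕ → ℝ) => (samplingTime p.2 Δ p.1).toNat :=
    measurable_from_prod_countable_right fun n => measurable_samplingTime_toNat Δ n
  exact h.comp ((measurable_samplingCount hΔ ht).prodMk measurable_id)

theorem measurable_overshoot (Δ : ℝ) : Measurable fun x => overshoot x Δ := by
  have h : Measurable fun p : ℕ × (ℕ → ℝ) => walk p.2 p.1 :=
    measurable_from_prod_countable_right fun n => measurable_walk n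
  exact (h.comp ((measurable_samplingTime_toNat Δ 1).prodMk measurable_id)).sub_const _

theorem measurable_nextPath (Δ : ℝ) : Measurable (nextPath Δ) := by
  have h : Measurable fun p : ℕ × (ℕ → ℝ) => shift p.1 p.2 :=
    measurable_from_prod_countable_right fun n => measurable_shift n
  exact h.comp ((measurable_samplingTime_toNat Δ 1).prodMk measurable_id)

/-! ### The Markov property of the path of increments -/

/-- The law of a sequence of i.i.d. increments. -/
abbrev pathLaw (Q : Measure ℝ) : Measure (ℕ → ℝ) := Measure.infinitePi fun _ : ℕ => Q

/-- The path which follows `p.1` before time `k` and continues with `p.2`. -/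
def concat (k : ℕ) (p : (ℕ → ℝ) × (ℕ → ℝ)) : ℕ → ℝ :=
  fun i => if i < k then p.1 i else p.2 (i - k)

@[fun_prop]
theorem measurable_concat (k : ℕ) : Measurable (concat k) := by
  refine measurable_pi_iff.2 fun i => ?_
  unfold concat
  split_ifs <;> fun_prop

theorem shift_concat (k : ℕ) (p : (ℕ → ℝ) × (ℕ → ℝ)) : shift k (concat k p) = p.2 := by
  funext i
  simp [shift, concat]

/-- Past and future are independent: gluing two independent copies at time `k` gives the same law,
as seen on cylinder sets. The Markov property at fixed times follows by integrating over the glued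
path. -/
theorem map_concat (Q : Measure ℝ) [IsProbabilityMeasure Q] (k : ℕ) :
    ((pathLaw Q).prod (pathLaw Q)).map (concat k) = pathLaw Q := by
  refine Measure.eq_infinitePi _ fun s t ht => ?_
  have hpre : concat k ⁻¹' (Set.pi s t) =
      (Set.pi (s.filter (· < k) : Finset ℕ) t) ×ˢ
        (Set.pi ((s.filter (¬ · < k)).image (· - k) : Finset ℕ) fun j => t (j + k)) := by
    ext p
    simp only [Set.mem_preimage, Set.mem_pi, SetLike.mem_coe, concat, Set.mem_prod,
      Finset.mem_filter, Finset.mem_image, not_lt, forall_exists_index, and_imp]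
    constructor
    · intro h
      refine ⟨fun i hi hik => by simpa [hik] using h i hi, ?_⟩
      rintro _ i hi hik rfl
      have := h i hi
      rw [if_neg (by omega)] at this
      rwa [Nat.sub_add_cancel hik]
    · rintro ⟨h1, h2⟩ i hi
      split_ifs with hik
      · exact h1 i hi hik
      · have := h2 _ i hi (by omega) rfl
        rwa [Nat.sub_add_cancel (by omega)] at this
  rw [Measure.map_apply (measurable_concat k)
      (MeasurableSet.pi (Finset.countable_toSet s) fun i _ => ht i), hpre, Measure.prod_prod,
    Measure.infinitePi_pi _ (fun i _ => ht i), Measure.infinitePi_pi _ (fun i _ => ht _),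
    Finset.prod_image, ← Finset.prod_filter_mul_prod_filter_not s (· < k)]
  · congr 1
    refine Finset.prod_congr rfl fun i hi => ?_
    rw [Finset.mem_filter] at hi
    rw [Nat.sub_add_cancel (by omega)]
  · intro i hi j hj hij
    simp only [SetLike.mem_coe, Finset.mem_filter] at hi hj
    simp only at hij
    omega

theorem lintegral_mul_shift (Q : Measure ℝ) [IsProbabilityMeasure Q] (k : ℕ)
    {f g : (ℕ → ℝ) → ENNReal} (hf : Measurable f) (hg : Measurable g)
    (hdep : ∀ x y, (∀ i < k, x i = y i) → f x = f y) :
    ∫⁻ x, f x * g (shift k x) ∂(pathLaw Q) =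
      (∫⁻ x, f x ∂(pathLaw Q)) * ∫⁻ x, g x ∂(pathLaw Q) := by
  conv_lhs => rw [← map_concat Q k]
  rw [lintegral_map (by fun_prop) (by fun_prop), ← lintegral_prod_mul hf.aemeasurable hg.aemeasurable]
  refine lintegral_congr fun p => ?_
  rw [shift_concat, hdep _ p.1 fun i hi => by simp [concat, hi]]

theorem integral_mul_shift (Q : Measure ℝ) [IsProbabilityMeasure Q] (k : ℕ)
    {f g : (ℕ → ℝ) → ℝ} (hf : Measurable f) (hg : Measurable g)
    (hdep : ∀ x y, (∀ i < k, x i = y i) → f x = f y) :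
    ∫ x, f x * g (shift k x) ∂(pathLaw Q) =
      (∫ x, f x ∂(pathLaw Q)) * ∫ x, g x ∂(pathLaw Q) := by
  conv_lhs => rw [← map_concat Q k]
  rw [integral_map (by fun_prop) (by fun_prop), ← integral_prod_mul]
  refine integral_congr_ae (Eventually.of_forall fun p => ?_)
  simp only
  rw [shift_concat, hdep _ p.1 fun i hi => by simp [concat, hi]]

theorem walk_congr {x y : ℕ → ℝ} {k : ℕ} (h : ∀ i < k, x i = y i) : walk x k = walk y k :=
  Finset.sum_congr rfl fun i hi => h i (Finset.mem_range.1 hi)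

/-! ### Wald's identities for the first sampling time -/

/-- The paths which have not reached the level `Δ` by time `i`. -/
def alive (Δ : ℝ) (i : ℕ) : Set (ℕ → ℝ) := {x | ∀ j ≤ i, walk x j < Δ}

theorem measurableSet_alive (Δ : ℝ) (i : ℕ) : MeasurableSet (alive Δ i) := by
  have : alive Δ i = ⋂ j, ⋂ _ : j ≤ i, {x | walk x j < Δ} := by
    ext x
    simp [alive]
  rw [this]
  exact .iInter fun j => .iInter fun _ => measurableSet_lt (by fun_prop) (by fun_prop)

theorem alive_congr {Δ : ℝ} {i : ℕ} {x y : ℕ → ℝ} (h : ∀ j < i, x j = y j) :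
    x ∈ alive Δ i ↔ y ∈ alive Δ i := by
  refine forall₂_congr fun j hj => ?_
  rw [walk_congr fun m hm => h m (by omega)]

theorem indicator_alive_congr {α : Type*} [Zero α] (c : α) {Δ : ℝ} {i : ℕ} {x y : ℕ → ℝ}
    (h : ∀ j < i, x j = y j) :
    (alive Δ i).indicator (fun _ => c) x = (alive Δ i).indicator (fun _ => c) y := by
  classical
  simp only [Set.indicator_apply, alive_congr h]

/-- Wald's identity: `{τ > i}` is determined by the first `i` increments, hence independent of the
next one, `x i`; and `∑ P(τ > i)` is `E[τ]`. -/
theorem lintegral_tsum_alive (Q : Measure ℝ) [IsProbabilityMeasure Q] (Δ : ℝ)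
    {f : ℝ → ENNReal} (hf : Measurable f) :
    ∫⁻ x, ∑' i, (alive Δ i).indicator (fun _ => 1) x * f (x i) ∂(pathLaw Q) =
      (∑' i, pathLaw Q (alive Δ i)) * ∫⁻ u, f u ∂Q := by
  rw [lintegral_tsum, ← ENNReal.tsum_mul_right]
  · refine tsum_congr fun i => ?_
    have := lintegral_mul_shift Q i (f := (alive Δ i).indicator fun _ => 1)
      (g := fun y => f (y 0)) (measurable_const.indicator (measurableSet_alive Δ i)) (by fun_prop)
      (fun x y h => indicator_alive_congr 1 h)
    simp only [shift, zero_add] at this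
    rw [this, lintegral_indicator_const (measurableSet_alive Δ i), one_mul,
      ← lintegral_map (μ := pathLaw Q) (f := f) hf (by fun_prop), Measure.infinitePi_map_eval]
  · intro i
    exact ((measurable_const.indicator (measurableSet_alive Δ i)).mul (by fun_prop)).aemeasurable

theorem integral_sum_alive (Q : Measure ℝ) [IsProbabilityMeasure Q] (Δ : ℝ)
    {f : ℝ → ℝ} (hf : Measurable f) (hint : Integrable f Q) (n : ℕ) :
    Integrable (fun x : ℕ → ℝ => ∑ i ∈ Finset.range n,
      (alive Δ i).indicator (fun _ => 1) x * f (x i)) (pathLaw Q) ∧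
    ∫ x, ∑ i ∈ Finset.range n, (alive Δ i).indicator (fun _ => 1) x * f (x i) ∂(pathLaw Q) =
      (∑ i ∈ Finset.range n, (pathLaw Q).real (alive Δ i)) * ∫ u, f u ∂Q := by
  have hi : ∀ i : ℕ, Integrable (fun x : ℕ → ℝ =>
      (alive Δ i).indicator (fun _ => (1 : ℝ)) x * f (x i)) (pathLaw Q) := by
    intro i
    have h1 : Integrable (fun x : ℕ → ℝ => f (x i)) (pathLaw Q) :=
      (measurePreserving_eval_infinitePi (fun _ : ℕ => Q) i).integrable_comp_of_integrable hint
    have h2 : (fun x : ℕ → ℝ => (alive Δ i).indicator (fun _ => (1 : ℝ)) x * f (x i)) =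
        (alive Δ i).indicator fun x => f (x i) := by
      ext x
      by_cases hx : x ∈ alive Δ i <;> simp [hx]
    rw [h2]
    exact h1.indicator (measurableSet_alive Δ i)
  refine ⟨integrable_finsetSum _ fun i _ => hi i, ?_⟩
  rw [integral_finsetSum _ fun i _ => hi i, Finset.sum_mul]
  refine Finset.sum_congr rfl fun i _ => ?_
  have := integral_mul_shift Q i (f := (alive Δ i).indicator fun _ => 1)
    (g := fun y => f (y 0)) (measurable_const.indicator (measurableSet_alive Δ i)) (by fun_prop)
    (fun x y h => indicator_alive_congr 1 h)
  simp only [shift, zero_add] at this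
  rw [this, integral_indicator_const _ (measurableSet_alive Δ i), smul_eq_mul, mul_one,
    ← integral_map (μ := pathLaw Q) (φ := fun y : ℕ → ℝ => y 0) (f := f)
      (measurable_pi_apply 0).aemeasurable
      hf.aestronglyMeasurable, Measure.infinitePi_map_eval]

theorem alive_iff_lt_samplingTime {Δ : ℝ} {i : ℕ} {x : ℕ → ℝ} :
    x ∈ alive Δ i ↔ (i : ℕ∞) < samplingTime x Δ 1 :=
  lt_samplingTime_one_iff.symm

/-- The left side is the walk stopped at `τ`: it is below `Δ` before its last increment, and that
increment is at most `K` plus its part above `K`. -/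
theorem sum_alive_le {Δ K : ℝ} (hK : 0 ≤ K) (hΔ : 0 < Δ) (x : ℕ → ℝ) (n : ℕ) :
    ∑ i ∈ Finset.range n, (alive Δ i).indicator (fun _ => 1) x * x i ≤
      Δ + K + ∑ i ∈ Finset.range n, (alive Δ i).indicator (fun _ => 1) x *
        (Set.Ioi K).indicator id (x i) := by
  have h0 : ∀ u : ℝ, 0 ≤ (Set.Ioi K).indicator id u := fun u =>
    Set.indicator_nonneg (fun v hv => hK.trans (le_of_lt hv)) u
  have h1 : ∀ (i : ℕ), 0 ≤ (alive Δ i).indicator (fun _ => (1 : ℝ)) x := fun i =>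
    Set.indicator_nonneg (fun _ _ => zero_le_one) x
  induction n with
  | zero => simp; positivity
  | succ n ih =>
    by_cases hx : x ∈ alive Δ n
    · have h2 : ∑ i ∈ Finset.range (n + 1), (alive Δ i).indicator (fun _ => 1) x * x i =
          walk x n + x n := by
        rw [← walk_succ, walk]
        refine Finset.sum_congr rfl fun i hi => ?_
        have hxi : x ∈ alive Δ i := fun j hj =>
          hx j (hj.trans (by have := Finset.mem_range.1 hi; omega))
        simp [hxi]
      have h3 : x n ≤ K + (Set.Ioi K).indicator id (x n) := by
        by_cases hn : K < x n
        · simp [hn, hK]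
        · rw [Set.indicator_of_notMem (by simpa using hn), add_zero]
          exact not_lt.1 hn
      rw [h2, Finset.sum_range_succ]
      have h4 := hx n le_rfl
      have h5 : 0 ≤ ∑ i ∈ Finset.range n, (alive Δ i).indicator (fun _ => 1) x *
        (Set.Ioi K).indicator id (x i) := Finset.sum_nonneg fun i _ => mul_nonneg (h1 i) (h0 _)
      simp only [Set.indicator_of_mem hx, one_mul]
      linarith
    · simp only [Finset.sum_range_succ, Set.indicator_of_notMem hx, zero_mul, add_zero]
      exact ih

/-- Truncation: the integral of `f` over large arguments is small. -/
theorem exists_integral_indicator_lt_abs_le {Q : Measure ℝ} {f : ℝ → ℝ} (hf : Integrable f Q)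
    {c : ℝ} (hc : 0 < c) :
    ∃ K : ℝ, 0 ≤ K ∧ ∫ u, {v : ℝ | K < |v|}.indicator f u ∂Q ≤ c := by
  have : Tendsto (fun K : ℕ => ∫ u, {v : ℝ | (K : ℝ) < |v|}.indicator f u ∂Q) atTop
      (𝓝 (∫ _u, (0 : ℝ) ∂Q)) := by
    refine tendsto_integral_of_dominated_convergence (fun u => ‖f u‖) (fun K => ?_) hf.norm
      (fun K => ?_) ?_
    · exact hf.aestronglyMeasurable.indicator
        (measurableSet_lt measurable_const (by fun_prop))
    · exact Eventually.of_forall fun u => norm_indicator_le_norm_self _ _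
    · refine Eventually.of_forall fun u => ?_
      obtain ⟨N, hN⟩ := exists_nat_ge |u|
      refine tendsto_const_nhds.congr' ?_
      filter_upwards [eventually_ge_atTop N] with K hK
      rw [Set.indicator_of_notMem]
      simp only [Set.mem_ofPred_eq, not_lt]
      exact hN.trans (by exact_mod_cast hK)
  rw [integral_zero] at this
  obtain ⟨K, hK⟩ := (this.eventually_le_const hc).exists
  exact ⟨K, by positivity, hK⟩

/-- With `K` such that the part of the mean above `K` is at most `μ / 2`, Wald's identity for
`sum_alive_le` gives `μ s ≤ Δ + K + s μ / 2`, with `s` a partial sum of `P(τ > i)`. Working with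
finite `n` keeps `s` finite, so the last term can be absorbed. -/
theorem exists_sum_alive_le (Q : Measure ℝ) [IsProbabilityMeasure Q]
    (hint : Integrable (fun u : ℝ => u) Q) (hμ : 0 < ∫ u, u ∂Q) :
    ∃ K : ℝ, 0 ≤ K ∧ ∀ Δ : ℝ, 0 < Δ →
      ∑' i, pathLaw Q (alive Δ i) ≤ ENNReal.ofReal (2 * (Δ + K) / ∫ u, u ∂Q) := by
  set μ := ∫ u, u ∂Q with hμdef
  obtain ⟨K, hK, hle⟩ := exists_integral_indicator_lt_abs_le hint.abs (half_pos hμ)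
  refine ⟨K, hK, fun Δ hΔ => ?_⟩
  have hind : Integrable ((Set.Ioi K).indicator (id : ℝ → ℝ)) Q :=
    Integrable.indicator hint measurableSet_Ioi
  have hle' : ∫ u, (Set.Ioi K).indicator (id : ℝ → ℝ) u ∂Q ≤ μ / 2 := by
    refine le_trans (integral_mono hind
      (hint.abs.indicator (measurableSet_lt measurable_const (by fun_prop))) fun u => ?_) hle
    by_cases hu : K < u
    · have : K < |u| := hu.trans_le (le_abs_self u)
      simp [hu, this, le_abs_self]
    · rw [Set.indicator_of_notMem (by simpa using hu)]
      exact Set.indicator_nonneg (fun v _ => abs_nonneg v) u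
  have hbound : ∀ n, ∑ i ∈ Finset.range n, (pathLaw Q).real (alive Δ i) ≤ 2 * (Δ + K) / μ := by
    intro n
    obtain ⟨i1, e1⟩ := integral_sum_alive Q Δ measurable_id hint n
    obtain ⟨i2, e2⟩ := integral_sum_alive Q Δ (measurable_id.indicator measurableSet_Ioi) hind n
    have := integral_mono i1 ((integrable_const (Δ + K)).add i2) fun x => sum_alive_le hK hΔ x n
    simp only [Pi.add_apply] at this
    rw [integral_add (integrable_const _) i2, e2, e1] at this
    simp only [id, integral_const, probReal_univ, one_smul, ← hμdef] at this
    have hs : 0 ≤ ∑ i ∈ Finset.range n, (pathLaw Q).real (alive Δ i) :=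
      Finset.sum_nonneg fun i _ => measureReal_nonneg
    rw [le_div_iff₀ hμ]
    have h3 := mul_le_mul_of_nonneg_left hle' hs
    linarith
  rw [ENNReal.tsum_eq_iSup_nat]
  refine iSup_le fun n => ?_
  have h4 : ∑ i ∈ Finset.range n, pathLaw Q (alive Δ i) =
      ENNReal.ofReal (∑ i ∈ Finset.range n, (pathLaw Q).real (alive Δ i)) := by
    rw [ENNReal.ofReal_sum_of_nonneg fun i _ => measureReal_nonneg]
    simp
  rw [h4]
  exact ENNReal.ofReal_le_ofReal (hbound n)

theorem ae_samplingTime_one_ne_top {Q : Measure ℝ} [IsProbabilityMeasure Q]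
    (hint : Integrable (fun u : ℝ => u) Q) (hμ : 0 < ∫ u, u ∂Q) {Δ : ℝ} (hΔ : 0 < Δ) :
    ∀ᵐ x ∂(pathLaw Q), samplingTime x Δ 1 ≠ ⊤ := by
  obtain ⟨K, -, hK⟩ := exists_sum_alive_le Q hint hμ
  have h0 := ENNReal.tendsto_atTop_zero_of_tsum_ne_top
    (ne_top_of_le_ne_top ENNReal.ofReal_ne_top (hK Δ hΔ))
  rw [ae_iff]
  refine le_antisymm (ge_of_tendsto' h0 fun i => measure_mono fun x hx => ?_) zero_le
  simp only [ne_eq, not_not, Set.mem_ofPred_eq] at hx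
  rw [alive_iff_lt_samplingTime, hx]
  exact ENat.natCast_lt_top i

theorem tsum_alive_mul {Δ : ℝ} {x : ℕ → ℝ} {k : ℕ} (hk : samplingTime x Δ 1 = k)
    (c : ℕ → ENNReal) :
    ∑' i, (alive Δ i).indicator (fun _ => 1) x * c i = ∑ i ∈ Finset.range k, c i := by
  rw [tsum_eq_sum (s := Finset.range k)]
  · refine Finset.sum_congr rfl fun i hi => ?_
    rw [Set.indicator_of_mem, one_mul]
    rw [alive_iff_lt_samplingTime, hk]
    exact_mod_cast Finset.mem_range.1 hi
  · intro i hi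
    rw [Set.indicator_of_notMem, zero_mul]
    rw [alive_iff_lt_samplingTime, hk]
    simpa using hi

theorem lintegral_samplingTime_one {Q : Measure ℝ} [IsProbabilityMeasure Q]
    (hint : Integrable (fun u : ℝ => u) Q) (hμ : 0 < ∫ u, u ∂Q) {Δ : ℝ} (hΔ : 0 < Δ) :
    ∫⁻ x, ((samplingTime x Δ 1).toNat : ENNReal) ∂(pathLaw Q) =
      ∑' i, pathLaw Q (alive Δ i) := by
  have h := lintegral_tsum_alive Q Δ (f := fun _ => 1) measurable_const
  rw [lintegral_const, measure_univ, one_mul, mul_one] at h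
  rw [← h]
  refine lintegral_congr_ae ?_
  filter_upwards [ae_samplingTime_one_ne_top hint hμ hΔ] with x hx
  obtain ⟨k, hk⟩ := ENat.ne_top_iff_exists.1 hx
  rw [tsum_alive_mul hk.symm, ← hk]
  simp

/-! ### The first sampling time and the overshoot -/

theorem integral_samplingTime_one {Q : Measure ℝ} [IsProbabilityMeasure Q]
    (hint : Integrable (fun u : ℝ => u) Q) (hμ : 0 < ∫ u, u ∂Q) {Δ : ℝ} (hΔ : 0 < Δ) :
    ∫ x, ((samplingTime x Δ 1).toNat : ℝ) ∂(pathLaw Q) =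
      (∑' i, pathLaw Q (alive Δ i)).toReal := by
  have hm : Measurable fun x => ((samplingTime x Δ 1).toNat : ℝ) :=
    measurable_from_nat.comp (measurable_samplingTime_toNat Δ 1)
  rw [integral_eq_lintegral_of_nonneg_ae (Eventually.of_forall fun x => Nat.cast_nonneg _)
      hm.aestronglyMeasurable,
    ← lintegral_samplingTime_one hint hμ hΔ]
  simp

theorem exists_integral_samplingTime_one_le (Q : Measure ℝ) [IsProbabilityMeasure Q]
    (hint : Integrable (fun u : ℝ => u) Q) (hμ : 0 < ∫ u, u ∂Q) :
    ∃ K : ℝ, 0 ≤ K ∧ ∀ Δ : ℝ, 0 < Δ →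
      ∫ x, ((samplingTime x Δ 1).toNat : ℝ) ∂(pathLaw Q) ≤ 2 * (Δ + K) / ∫ u, u ∂Q := by
  obtain ⟨K, hK, h⟩ := exists_sum_alive_le Q hint hμ
  refine ⟨K, hK, fun Δ hΔ => ?_⟩
  rw [integral_samplingTime_one hint hμ hΔ]
  exact ENNReal.toReal_le_of_le_ofReal (by positivity) (h Δ hΔ)

/-- Wald's identity applied to `Δ ≤ S_τ ≤ ∑_{i<τ} |X_{i+1}|`. With the upper bound on `E[τ]`, this
makes `δ` and `Δ` comparable. -/
theorem le_integral_samplingTime_one_mul {Q : Measure ℝ} [IsProbabilityMeasure Q]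
    (hint : Integrable (fun u : ℝ => u) Q) (hμ : 0 < ∫ u, u ∂Q) {Δ : ℝ} (hΔ : 0 < Δ) :
    Δ ≤ (∫ x, ((samplingTime x Δ 1).toNat : ℝ) ∂(pathLaw Q)) * ∫ u, |u| ∂Q := by
  have h := lintegral_tsum_alive Q Δ (f := fun u => ‖u‖ₑ) (by fun_prop)
  have h1 : ENNReal.ofReal Δ ≤ ∫⁻ x, ∑' i, (alive Δ i).indicator (fun _ => 1) x * ‖x i‖ₑ
      ∂(pathLaw Q) := by
    have h0 : ENNReal.ofReal Δ = ∫⁻ _x, ENNReal.ofReal Δ ∂(pathLaw Q) := by simp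
    rw [h0]
    refine lintegral_mono_ae ?_
    filter_upwards [ae_samplingTime_one_ne_top hint hμ hΔ] with x hx
    obtain ⟨k, hk⟩ := ENat.ne_top_iff_exists.1 hx
    rw [tsum_alive_mul hk.symm]
    calc ENNReal.ofReal Δ ≤ ENNReal.ofReal (walk x k) :=
          ENNReal.ofReal_le_ofReal (samplingTime_one_eq_coe_iff.1 hk.symm).1
      _ ≤ ‖walk x k‖ₑ := Real.ofReal_le_enorm _
      _ ≤ ∑ i ∈ Finset.range k, ‖x i‖ₑ := enorm_sum_le _ _
  rw [h] at h1
  obtain ⟨K, -, hK⟩ := exists_sum_alive_le Q hint hμ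
  have hfin : (∑' i, pathLaw Q (alive Δ i)) * ∫⁻ u, ‖u‖ₑ ∂Q ≠ ⊤ :=
    ENNReal.mul_ne_top (ne_top_of_le_ne_top ENNReal.ofReal_ne_top (hK Δ hΔ)) hint.2.ne
  have h2 := ENNReal.toReal_mono hfin h1
  rw [ENNReal.toReal_ofReal hΔ.le, ENNReal.toReal_mul] at h2
  rw [integral_samplingTime_one hint hμ hΔ]
  convert h2 using 2
  exact integral_norm_eq_lintegral_enorm hint.1

/-- The overshoot is at most the crossing increment, so `η²` is at most `K²` plus the sum over `i <
τ` of the squared increments exceeding `K` in absolute value. By Wald that sum has mean `E[τ]` times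
a truncated second moment, made small by the choice of `K`. As `c` is arbitrary, `E[η²] = o(Δ)`. -/
theorem exists_integral_overshoot_sq_le (Q : Measure ℝ) [IsProbabilityMeasure Q]
    (h2 : MemLp (fun u : ℝ => u) 2 Q) (hμ : 0 < ∫ u, u ∂Q) {c : ℝ} (hc : 0 < c) :
    ∃ K : ℝ, 0 ≤ K ∧ ∀ Δ : ℝ, 0 < Δ → MemLp (fun x => overshoot x Δ) 2 (pathLaw Q) ∧
      ∫ x, overshoot x Δ ^ 2 ∂(pathLaw Q) ≤ K + c * Δ := by
  have hint : Integrable (fun u : ℝ => u) Q := h2.integrable one_le_two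
  have hsq : Integrable (fun u : ℝ => u ^ 2) Q := h2.integrable_sq
  set μ := ∫ u, u ∂Q with hμdef
  obtain ⟨K₀, hK₀, hT⟩ := exists_sum_alive_le Q hint hμ
  obtain ⟨K, hK, hle⟩ := exists_integral_indicator_lt_abs_le hsq (c := c * μ / 2) (by positivity)
  set f : ℝ → ℝ := {v : ℝ | K < |v|}.indicator fun u => u ^ 2 with hf
  have hf0 : ∀ u, 0 ≤ f u := fun u => Set.indicator_nonneg (fun v _ => sq_nonneg v) u
  have hmeas : MeasurableSet {v : ℝ | K < |v|} :=
    measurableSet_lt measurable_const (by fun_prop)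
  have hfm : Measurable f := Measurable.indicator (by fun_prop) hmeas
  refine ⟨K ^ 2 + c * K₀, by positivity, fun Δ hΔ => ?_⟩
  have key : ∫⁻ x, ENNReal.ofReal (overshoot x Δ ^ 2) ∂(pathLaw Q) ≤
      ENNReal.ofReal (K ^ 2 + c * K₀ + c * Δ) := by
    calc ∫⁻ x, ENNReal.ofReal (overshoot x Δ ^ 2) ∂(pathLaw Q)
        ≤ ∫⁻ x, (ENNReal.ofReal (K ^ 2) + ∑' i, (alive Δ i).indicator (fun _ => 1) x *
            ENNReal.ofReal (f (x i))) ∂(pathLaw Q) := by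
          refine lintegral_mono_ae ?_
          filter_upwards [ae_samplingTime_one_ne_top hint hμ hΔ] with x hx
          obtain ⟨k, hk⟩ := ENat.ne_top_iff_exists.1 hx
          obtain ⟨j, rfl, hj⟩ := overshoot_le_increment hΔ hk.symm
          have h0 := overshoot_nonneg hx
          rw [tsum_alive_mul hk.symm,
            ← ENNReal.ofReal_sum_of_nonneg fun i _ => hf0 _,
            ← ENNReal.ofReal_add (by positivity) (Finset.sum_nonneg fun i _ => hf0 _)]
          refine ENNReal.ofReal_le_ofReal ?_
          have h1 : f (x j) ≤ ∑ i ∈ Finset.range (j + 1), f (x i) :=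
            Finset.single_le_sum (f := fun i => f (x i)) (fun i _ => hf0 _)
              (Finset.self_mem_range_succ j)
          have h3 : x j ^ 2 ≤ K ^ 2 + f (x j) := by
            by_cases hx : K < |x j|
            · simp only [hf, Set.indicator_of_mem (show x j ∈ {v : ℝ | K < |v|} from hx)]
              nlinarith
            · have : x j ^ 2 ≤ K ^ 2 := sq_le_sq' (by linarith [neg_abs_le (x j)])
                (by linarith [le_abs_self (x j)])
              linarith [hf0 (x j)]
          have h4 : overshoot x Δ ^ 2 ≤ x j ^ 2 := pow_le_pow_left₀ h0 hj 2
          linarith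
      _ = ENNReal.ofReal (K ^ 2) +
            (∑' i, pathLaw Q (alive Δ i)) * ∫⁻ u, ENNReal.ofReal (f u) ∂Q := by
          rw [lintegral_add_left measurable_const, lintegral_const, measure_univ, mul_one,
            lintegral_tsum_alive Q Δ (f := fun u => ENNReal.ofReal (f u)) hfm.ennreal_ofReal]
      _ ≤ ENNReal.ofReal (K ^ 2) +
            ENNReal.ofReal (2 * (Δ + K₀) / μ) * ENNReal.ofReal (c * μ / 2) := by
          gcongr
          · exact hT Δ hΔ
          · rw [← ofReal_integral_eq_lintegral_ofReal (hsq.indicator hmeas)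
              (Eventually.of_forall hf0)]
            exact ENNReal.ofReal_le_ofReal hle
      _ = ENNReal.ofReal (K ^ 2 + c * K₀ + c * Δ) := by
          rw [← ENNReal.ofReal_mul (by positivity), ← ENNReal.ofReal_add (by positivity)
            (by positivity)]
          congr 1
          field_simp
          ring
  have hm : AEStronglyMeasurable (fun x => overshoot x Δ) (pathLaw Q) :=
    (measurable_overshoot Δ).aestronglyMeasurable
  refine ⟨(memLp_two_iff_integrable_sq hm).2 ⟨hm.pow 2, ?_⟩, ?_⟩
  · rw [hasFiniteIntegral_iff_ofReal (Eventually.of_forall fun x => sq_nonneg _)]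
    exact key.trans_lt ENNReal.ofReal_lt_top
  · rw [integral_eq_lintegral_of_nonneg_ae (Eventually.of_forall fun x => sq_nonneg _)
      (hm.pow 2)]
    exact ENNReal.toReal_le_of_le_ofReal (by positivity) key

/-! ### The renewal property -/

theorem map_prodMk_eq_prod {E F : Type*} [MeasurableSpace E] [MeasurableSpace F] {P : Measure E}
    [IsProbabilityMeasure P] {ξ : E → F} {Φ : E → E} (hξ : Measurable ξ) (hΦ : Measurable Φ)
    (h : ∀ (g : F → ENNReal) (f : E → ENNReal), Measurable g → Measurable f →
      ∫⁻ x, g (ξ x) * f (Φ x) ∂P = (∫⁻ x, g (ξ x) ∂P) * ∫⁻ x, f x ∂P) :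
    P.map (fun x => (ξ x, Φ x)) = (P.map ξ).prod P := by
  have := Measure.isProbabilityMeasure_map (μ := P) hξ.aemeasurable
  refine (Measure.prod_eq fun s t hs ht => ?_).symm
  have := h (s.indicator 1) (t.indicator 1) (measurable_one.indicator hs)
    (measurable_one.indicator ht)
  rw [← lintegral_map (f := s.indicator 1) (measurable_one.indicator hs) hξ,
    lintegral_indicator_one hs, lintegral_indicator_one ht] at this
  rw [← this, Measure.map_apply (hξ.prodMk hΦ) (hs.prod ht),
    ← lintegral_indicator_one ((hξ.prodMk hΦ) (hs.prod ht))]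
  refine lintegral_congr fun x => ?_
  by_cases h1 : ξ x ∈ s <;> by_cases h2 : Φ x ∈ t <;> simp [h1, h2]

theorem map_head_shift (Q : Measure ℝ) [IsProbabilityMeasure Q] {f : ℝ → ℝ} (hf : Measurable f) :
    (pathLaw Q).map (fun x => (f (x 0), shift 1 x)) =
      ((pathLaw Q).map fun x => f (x 0)).prod (pathLaw Q) := by
  refine map_prodMk_eq_prod (by fun_prop) (by fun_prop) fun g h hg hh => ?_
  exact lintegral_mul_shift Q 1 (f := fun x => g (f (x 0))) (by fun_prop) hh
    fun x y hxy => by rw [hxy 0 one_pos]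

theorem tsum_samplingTime_eq {Δ : ℝ} {x : ℕ → ℝ} {k : ℕ} (hk : samplingTime x Δ 1 = k)
    (c : ℕ → ENNReal) :
    ∑' i : ℕ, {y | samplingTime y Δ 1 = i}.indicator (fun _ => 1) x * c i = c k := by
  rw [tsum_eq_single k]
  · simp [hk]
  · intro i hi
    rw [Set.indicator_of_notMem, zero_mul]
    simp only [Set.mem_ofPred_eq, hk]
    exact fun h => hi (by exact_mod_cast h.symm)

/-- Strong Markov property at `τ`: split according to the value of `τ` and use the Markov property
at each fixed time. -/
theorem lintegral_overshoot_mul_nextPath {Q : Measure ℝ} [IsProbabilityMeasure Q]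
    (hint : Integrable (fun u : ℝ => u) Q) (hμ : 0 < ∫ u, u ∂Q) {Δ : ℝ} (hΔ : 0 < Δ)
    {g : ℝ → ENNReal} {f : (ℕ → ℝ) → ENNReal} (hg : Measurable g) (hf : Measurable f) :
    ∫⁻ x, g (overshoot x Δ) * f (nextPath Δ x) ∂(pathLaw Q) =
      (∫⁻ x, g (overshoot x Δ) ∂(pathLaw Q)) * ∫⁻ x, f x ∂(pathLaw Q) := by
  have hind : ∀ i : ℕ, Measurable fun x : ℕ → ℝ =>
      {y | samplingTime y Δ 1 = i}.indicator (fun _ => (1 : ENNReal)) x := fun i =>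
    measurable_const.indicator (measurableSet_samplingTime_eq Δ 1 i)
  have main : ∀ f : (ℕ → ℝ) → ENNReal, Measurable f →
      ∫⁻ x, g (overshoot x Δ) * f (nextPath Δ x) ∂(pathLaw Q) =
      (∑' i : ℕ, ∫⁻ x, {y | samplingTime y Δ 1 = i}.indicator (fun _ => 1) x *
        g (walk x i - Δ) ∂(pathLaw Q)) * ∫⁻ x, f x ∂(pathLaw Q) := by
    intro f hf
    rw [← ENNReal.tsum_mul_right]
    trans ∫⁻ x, ∑' i : ℕ, ({y | samplingTime y Δ 1 = i}.indicator (fun _ => 1) x *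
        g (walk x i - Δ)) * f (shift i x) ∂(pathLaw Q)
    · refine lintegral_congr_ae ?_
      filter_upwards [ae_samplingTime_one_ne_top hint hμ hΔ] with x hx
      obtain ⟨k, hk⟩ := ENat.ne_top_iff_exists.1 hx
      simp only [mul_assoc]
      rw [tsum_samplingTime_eq hk.symm, overshoot, nextPath, ← hk, ENat.toNat_natCast]
    · have hgi : ∀ i : ℕ, Measurable fun x : ℕ → ℝ => g (walk x i - Δ) := fun i => by fun_prop
      have hfi : ∀ i : ℕ, Measurable fun x : ℕ → ℝ => f (shift i x) := fun i => by fun_prop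
      rw [lintegral_tsum]
      swap
      · exact fun i => (((hind i).mul (hgi i)).mul (hfi i)).aemeasurable
      refine tsum_congr fun i => lintegral_mul_shift Q i
        (f := fun x => {y | samplingTime y Δ 1 = i}.indicator (fun _ => 1) x * g (walk x i - Δ))
        ((hind i).mul (by fun_prop)) hf fun x y hxy => ?_
      have h1 : ∀ j ≤ i, walk x j = walk y j := fun j hj =>
        walk_congr fun m hm => hxy m (by omega)
      classical
      simp only [Set.indicator_apply, Set.mem_ofPred_eq, samplingTime_one_eq_coe_iff, h1 i le_rfl]
      congr 2
      exact propext (and_congr_right fun _ => forall₂_congr fun j hj => by rw [h1 j hj.le])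
  -- Testing with `f = 1` identifies the series in `main` as the integral of `g (overshoot x Δ)`.
  have h1 := main (fun _ => 1) measurable_const
  simp only [mul_one, lintegral_const, measure_univ] at h1
  rw [main f hf, h1]

theorem map_overshoot_nextPath {Q : Measure ℝ} [IsProbabilityMeasure Q]
    (hint : Integrable (fun u : ℝ => u) Q) (hμ : 0 < ∫ u, u ∂Q) {Δ : ℝ} (hΔ : 0 < Δ) (e : ℝ) :
    (pathLaw Q).map (fun x => (overshoot x Δ - e, nextPath Δ x)) =
      ((pathLaw Q).map fun x => overshoot x Δ - e).prod (pathLaw Q) := by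
  refine map_prodMk_eq_prod ((measurable_overshoot Δ).sub_const e) (measurable_nextPath Δ)
    fun g f hg hf => ?_
  exact lintegral_overshoot_mul_nextPath hint hμ hΔ (g := fun u => g (u - e)) (by fun_prop) hf

theorem measurePreserving_of_map_prodMk {E F : Type*} [MeasurableSpace E] [MeasurableSpace F]
    {P : Measure E} [IsProbabilityMeasure P] {ξ : E → F} {Φ : E → E} (hξ : Measurable ξ)
    (hΦ : Measurable Φ) (h : P.map (fun x => (ξ x, Φ x)) = (P.map ξ).prod P) :
    MeasurePreserving Φ P P := by
  have := Measure.isProbabilityMeasure_map (μ := P) hξ.aemeasurable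
  refine ⟨hΦ, ?_⟩
  have h1 := congrArg Measure.snd h
  rwa [Measure.snd_prod, Measure.snd_map_prodMk hξ] at h1

theorem ae_samplingTime_iterate_ne_top {Q : Measure ℝ} [IsProbabilityMeasure Q]
    (hint : Integrable (fun u : ℝ => u) Q) (hμ : 0 < ∫ u, u ∂Q) {Δ : ℝ} (hΔ : 0 < Δ) :
    ∀ᵐ x ∂(pathLaw Q), ∀ i, samplingTime ((nextPath Δ)^[i] x) Δ 1 ≠ ⊤ := by
  rw [ae_all_iff]
  intro i
  have hp := (measurePreserving_of_map_prodMk ((measurable_overshoot Δ).sub_const 0)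
    (measurable_nextPath Δ) (map_overshoot_nextPath hint hμ hΔ 0)).iterate i
  exact hp.quasiMeasurePreserving.ae (ae_samplingTime_one_ne_top hint hμ hΔ)

/-! ### Kolmogorov's maximal inequality along a renewal map -/

/-- Induction on `n` for all starting points `a` at once. If `|a| ≥ ε` the bound is at least `1`;
otherwise condition on the first step, which moves `a` to `a + ξ` and restarts the process, and use
`E[(a + ξ)²] = a² + v`. -/
theorem measure_exists_le_abs_sum_iterate_le {E : Type*} [MeasurableSpace E] {P : Measure E}
    [IsProbabilityMeasure P] {ξ : E → ℝ} {Φ : E → E} (hξ : Measurable ξ) (hΦ : Measurable Φ)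
    (hlaw : P.map (fun x => (ξ x, Φ x)) = (P.map ξ).prod P) (h2 : MemLp ξ 2 P)
    (h0 : ∫ x, ξ x ∂P = 0) {ε : ℝ} (hε : 0 < ε) (n : ℕ) (a : ℝ) :
    P {x | ∃ k ≤ n, ε ≤ |a + ∑ i ∈ Finset.range k, ξ (Φ^[i] x)|} ≤
      ENNReal.ofReal ((a ^ 2 + n * ∫ x, ξ x ^ 2 ∂P) / ε ^ 2) := by
  set v := ∫ x, ξ x ^ 2 ∂P with hv
  have hv0 : 0 ≤ v := integral_nonneg fun x => sq_nonneg _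
  induction n generalizing a with
  | zero =>
    by_cases ha : ε ≤ |a|
    · refine prob_le_one.trans ?_
      rw [← ENNReal.ofReal_one]
      refine ENNReal.ofReal_le_ofReal ((one_le_div (by positivity)).2 ?_)
      rw [← sq_abs a]
      have := pow_le_pow_left₀ hε.le ha 2
      simpa using this
    · simp [ha]
  | succ n ih =>
    by_cases ha : ε ≤ |a|
    · refine prob_le_one.trans ?_
      rw [← ENNReal.ofReal_one]
      refine ENNReal.ofReal_le_ofReal ((one_le_div (by positivity)).2 ?_)
      rw [← sq_abs a]
      have := pow_le_pow_left₀ hε.le ha 2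
      have : 0 ≤ ((n + 1 : ℕ) : ℝ) * v := by positivity
      linarith
    set B : Set (ℝ × E) := {p | ∃ k ≤ n, ε ≤ |a + p.1 + ∑ i ∈ Finset.range k, ξ (Φ^[i] p.2)|}
      with hB
    have hBm : MeasurableSet B := by
      have : B = ⋃ k, ⋃ _ : k ≤ n,
          {p : ℝ × E | ε ≤ |a + p.1 + ∑ i ∈ Finset.range k, ξ (Φ^[i] p.2)|} := by
        ext p
        simp [hB]
      rw [this]
      refine .iUnion fun k => .iUnion fun _ => measurableSet_le measurable_const ?_
      refine Measurable.abs (Measurable.add (by fun_prop) (Finset.measurable_fun_sum _ ?_))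
      exact fun i _ => (hξ.comp (hΦ.iterate i)).comp measurable_snd
    have hset : {x | ∃ k ≤ n + 1, ε ≤ |a + ∑ i ∈ Finset.range k, ξ (Φ^[i] x)|} =
        (fun x => (ξ x, Φ x)) ⁻¹' B := by
      ext x
      simp only [hB, Set.mem_ofPred_eq, Set.mem_preimage]
      have hstep : ∀ k, a + ξ x + ∑ i ∈ Finset.range k, ξ (Φ^[i] (Φ x)) =
          a + ∑ i ∈ Finset.range (k + 1), ξ (Φ^[i] x) := by
        intro k
        rw [Finset.sum_range_succ']
        simp only [Function.iterate_succ_apply, Function.iterate_zero, id]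
        ring
      simp only [hstep]
      constructor
      · rintro ⟨k, hk, h⟩
        cases k with
        | zero => exact absurd (by simpa using h) ha
        | succ k => exact ⟨k, by omega, h⟩
      · rintro ⟨k, hk, h⟩
        exact ⟨k + 1, by omega, h⟩
    have hξi : Integrable ξ P := h2.integrable one_le_two
    have hsq : Integrable (fun x => ξ x ^ 2) P := h2.integrable_sq
    have hpr := Measure.isProbabilityMeasure_map (μ := P) hξ.aemeasurable
    have hexp : (fun x => ((a + ξ x) ^ 2 + n * v) / ε ^ 2) =
        fun x => (ε ^ 2)⁻¹ * ((a ^ 2 + n * v) + (2 * a * ξ x + ξ x ^ 2)) := by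
      ext x
      field_simp
      ring
    have hI1 : Integrable (fun x => 2 * a * ξ x + ξ x ^ 2) P := (hξi.const_mul _).add hsq
    have hI2 : Integrable (fun x => ((a + ξ x) ^ 2 + n * v) / ε ^ 2) P := by
      rw [hexp]
      exact (Integrable.add (integrable_const _) hI1).const_mul _
    rw [hset, ← Measure.map_apply (hξ.prodMk hΦ) hBm, hlaw, Measure.prod_apply hBm,
      lintegral_map (measurable_measure_prodMk_left hBm) hξ]
    calc ∫⁻ x, P (Prod.mk (ξ x) ⁻¹' B) ∂P
        ≤ ∫⁻ x, ENNReal.ofReal (((a + ξ x) ^ 2 + n * v) / ε ^ 2) ∂P :=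
          lintegral_mono fun x => ih (a + ξ x)
      _ = ENNReal.ofReal (∫ x, ((a + ξ x) ^ 2 + n * v) / ε ^ 2 ∂P) :=
          (ofReal_integral_eq_lintegral_ofReal hI2
            (Eventually.of_forall fun x => by simp only [Pi.zero_apply]; positivity)).symm
      _ = ENNReal.ofReal ((a ^ 2 + ((n + 1 : ℕ) : ℝ) * v) / ε ^ 2) := by
          rw [hexp, integral_const_mul, integral_add (integrable_const _) hI1,
            integral_add (hξi.const_mul _) hsq, integral_const_mul, h0, ← hv]
          simp only [integral_const, probReal_univ, smul_eq_mul]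
          congr 1
          push_cast
          field_simp
          ring

theorem sum_iterate_shift (x : ℕ → ℝ) (m : ℝ) (k : ℕ) :
    ∑ i ∈ Finset.range k, ((shift 1)^[i] x 0 - m) = walk x k - k * m := by
  have : ∀ i, (shift 1)^[i] x = shift i x := by
    intro i
    induction i with
    | zero => rfl
    | succ i ih => rw [Function.iterate_succ_apply', ih, shift_shift]
  simp [this, shift, walk]

/-- Kolmogorov's inequality for the fluctuations of the walk after time `a`. -/
theorem measure_exists_le_abs_walk_sub_le {Q : Measure ℝ} [IsProbabilityMeasure Q]
    (h2 : MemLp (fun u : ℝ => u) 2 Q) {ε : ℝ} (hε : 0 < ε) (a n : ℕ) :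
    pathLaw Q {x | ∃ k ≤ n, ε ≤ |(walk x (a + k) - walk x a) - k * ∫ u, u ∂Q|} ≤
      ENNReal.ofReal (n * Var[id; Q] / ε ^ 2) := by
  set μ := ∫ u, u ∂Q with hμ
  have hint : Integrable (fun u : ℝ => u) Q := h2.integrable one_le_two
  have hmp : MeasurePreserving (fun x : ℕ → ℝ => x 0) (pathLaw Q) Q :=
    measurePreserving_eval_infinitePi (fun _ : ℕ => Q) 0
  have hmp' : MeasurePreserving (shift a) (pathLaw Q) (pathLaw Q) := by
    refine ⟨measurable_shift a, Measure.ext fun s hs => ?_⟩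
    have := lintegral_mul_shift Q a (f := fun _ => 1) (g := s.indicator 1) measurable_const
      (measurable_one.indicator hs) fun _ _ _ => rfl
    simp only [one_mul, lintegral_const, measure_univ, lintegral_indicator_one hs] at this
    rw [← this, ← lintegral_map (f := s.indicator 1) (measurable_one.indicator hs)
      (measurable_shift a), lintegral_indicator_one hs]
  have hcomp : ∀ f : ℝ → ℝ, Measurable f → ∫ x, f (x 0) ∂(pathLaw Q) = ∫ u, f u ∂Q := by
    intro f hf
    have := integral_map (f := f) hmp.aemeasurable hf.aestronglyMeasurable
    rw [hmp.map_eq] at this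
    exact this.symm
  have hmain := measure_exists_le_abs_sum_iterate_le (P := pathLaw Q) (ξ := fun x => x 0 - μ)
    (Φ := shift 1) (by fun_prop) (by fun_prop) (map_head_shift Q (f := fun u => u - μ) (by fun_prop))
    ((h2.sub (memLp_const μ)).comp_measurePreserving hmp)
    (by
      rw [hcomp (fun u => u - μ) (by fun_prop), integral_sub hint (integrable_const _)]
      simp [hμ]) hε n 0
  have hvar : Var[id; Q] = ∫ x : ℕ → ℝ, (x 0 - μ) ^ 2 ∂(pathLaw Q) := by
    rw [hcomp (fun u => (u - μ) ^ 2) (by fun_prop), variance_eq_integral (by fun_prop)]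
    simp [hμ]
  simp only [sum_iterate_shift, zero_add, ne_eq, OfNat.ofNat_ne_zero, not_false_eq_true,
    zero_pow, ← hvar] at hmain
  refine le_trans ?_ ((hmp'.measure_preimage_le _).trans hmain)
  refine measure_mono fun x hx => ?_
  simpa only [Set.mem_preimage, Set.mem_ofPred_eq, walk_shift] using hx

/-- Kolmogorov's inequality for the sums of the successive overshoots. -/
theorem measure_exists_le_abs_sum_overshoot_le {Q : Measure ℝ} [IsProbabilityMeasure Q]
    (h2 : MemLp (fun u : ℝ => u) 2 Q) (hμ : 0 < ∫ u, u ∂Q) {Δ : ℝ} (hΔ : 0 < Δ)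
    {ε : ℝ} (hε : 0 < ε) (n : ℕ) :
    pathLaw Q {x | ∃ k ≤ n, ε ≤ |∑ i ∈ Finset.range k, overshoot ((nextPath Δ)^[i] x) Δ -
        k * ∫ y, overshoot y Δ ∂(pathLaw Q)|} ≤
      ENNReal.ofReal (n * (∫ y, overshoot y Δ ^ 2 ∂(pathLaw Q)) / ε ^ 2) := by
  have hint : Integrable (fun u : ℝ => u) Q := h2.integrable one_le_two
  obtain ⟨K, -, hK⟩ := exists_integral_overshoot_sq_le Q h2 hμ one_pos
  have hm := (hK Δ hΔ).1
  set e := ∫ y, overshoot y Δ ∂(pathLaw Q) with he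
  have hmain := measure_exists_le_abs_sum_iterate_le (P := pathLaw Q)
    (ξ := fun x => overshoot x Δ - e) (Φ := nextPath Δ) ((measurable_overshoot Δ).sub_const e)
    (measurable_nextPath Δ) (map_overshoot_nextPath hint hμ hΔ e) (hm.sub (memLp_const e))
    (by
      rw [integral_sub (hm.integrable one_le_two) (integrable_const _)]
      simp [he]) hε n 0
  simp only [zero_add, ne_eq, OfNat.ofNat_ne_zero, not_false_eq_true, zero_pow,
    Finset.sum_sub_distrib, Finset.sum_const, Finset.card_range, nsmul_eq_mul] at hmain
  refine hmain.trans (ENNReal.ofReal_le_ofReal ?_)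
  have hvar : ∫ x, (overshoot x Δ - e) ^ 2 ∂(pathLaw Q) ≤
      ∫ y, overshoot y Δ ^ 2 ∂(pathLaw Q) := by
    rw [he, ← variance_eq_integral (measurable_overshoot Δ).aemeasurable]
    exact variance_le_expectation_sq (measurable_overshoot Δ).aestronglyMeasurable
  gcongr

/-! ### Good paths -/

/-- Paths whose fluctuations up to time `t` are controlled: those of the walk by `A √t`, those of
the walk over the final `β t` steps and those of the overshoots by multiples of `ζ √t`. -/
structure IsGood (μ e A β ζ Δ t : ℝ) (x : ℕ → ℝ) : Prop where
  finite : ∀ i, samplingTime ((nextPath Δ)^[i] x) Δ 1 ≠ ⊤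
  walk_bound : ∀ k ≤ ⌊t⌋₊, |walk x k - k * μ| < A * √t
  recent_bound : ∀ k ≤ ⌊β * t⌋₊,
    |(walk x (⌊t⌋₊ - ⌊β * t⌋₊ + k) - walk x (⌊t⌋₊ - ⌊β * t⌋₊)) - k * μ| < ζ * √t
  overshoot_bound : ∀ k ≤ ⌊(μ + A) * t / Δ⌋₊,
    |∑ i ∈ Finset.range k, overshoot ((nextPath Δ)^[i] x) Δ - k * e| < ζ * √t

/-- A union bound over three applications of Kolmogorov's inequality. The factor `t` cancels in
each, leaving `E[η²] / Δ` as the only quantity that varies. -/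
theorem measure_not_isGood_le {Q : Measure ℝ} [IsProbabilityMeasure Q]
    (h2 : MemLp (fun u : ℝ => u) 2 Q) (hμ : 0 < ∫ u, u ∂Q) {A β ζ Δ t : ℝ} (hA : 0 < A)
    (hβ : 0 < β) (hζ : 0 < ζ) (hΔ : 0 < Δ) (ht : 0 < t) :
    pathLaw Q {x | ¬ IsGood (∫ u, u ∂Q) (∫ y, overshoot y Δ ∂(pathLaw Q)) A β ζ Δ t x} ≤
      ENNReal.ofReal (Var[id; Q] / A ^ 2 + β * Var[id; Q] / ζ ^ 2 +
        ((∫ u, u ∂Q) + A) / ζ ^ 2 * ((∫ y, overshoot y Δ ^ 2 ∂(pathLaw Q)) / Δ)) := by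
  have hint : Integrable (fun u : ℝ => u) Q := h2.integrable one_le_two
  set μ := ∫ u, u ∂Q with hμdef
  set e := ∫ y, overshoot y Δ ∂(pathLaw Q) with he
  set v := Var[id; Q] with hv
  have hv0 : 0 ≤ v := variance_nonneg _ _
  set q := ∫ y, overshoot y Δ ^ 2 ∂(pathLaw Q) with hq
  have hq0 : 0 ≤ q := integral_nonneg fun _ => sq_nonneg _
  have hs : 0 < √t := Real.sqrt_pos.2 ht
  have hst : √t ^ 2 = t := Real.sq_sqrt ht.le
  have h0 : pathLaw Q {x | ¬ ∀ i, samplingTime ((nextPath Δ)^[i] x) Δ 1 ≠ ⊤} = 0 :=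
    ae_iff.1 (ae_samplingTime_iterate_ne_top hint hμ hΔ)
  have h1 := measure_exists_le_abs_walk_sub_le h2 (mul_pos hA hs) 0 ⌊t⌋₊
  have h3 := measure_exists_le_abs_walk_sub_le h2 (mul_pos hζ hs) (⌊t⌋₊ - ⌊β * t⌋₊) ⌊β * t⌋₊
  have h4 := measure_exists_le_abs_sum_overshoot_le h2 hμ hΔ (mul_pos hζ hs) ⌊(μ + A) * t / Δ⌋₊
  rw [← hμdef, ← hv] at h1 h3
  rw [← he, ← hq] at h4
  simp only [zero_add, walk_zero, sub_zero] at h1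
  have e1 : (⌊t⌋₊ : ℝ) * v / (A * √t) ^ 2 ≤ v / A ^ 2 := by
    rw [mul_pow, hst, div_le_div_iff₀ (by positivity) (by positivity)]
    have := mul_le_mul_of_nonneg_right (Nat.floor_le ht.le) (mul_nonneg hv0 (sq_nonneg A))
    linarith
  have e3 : (⌊β * t⌋₊ : ℝ) * v / (ζ * √t) ^ 2 ≤ β * v / ζ ^ 2 := by
    rw [mul_pow, hst, div_le_div_iff₀ (by positivity) (by positivity)]
    have := mul_le_mul_of_nonneg_right (Nat.floor_le (mul_pos hβ ht).le)
      (mul_nonneg hv0 (sq_nonneg ζ))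
    linarith
  have e4 : (⌊(μ + A) * t / Δ⌋₊ : ℝ) * q / (ζ * √t) ^ 2 ≤ (μ + A) / ζ ^ 2 * (q / Δ) := by
    rw [mul_pow, hst]
    calc (⌊(μ + A) * t / Δ⌋₊ : ℝ) * q / (ζ ^ 2 * t)
        ≤ ((μ + A) * t / Δ) * q / (ζ ^ 2 * t) := by
          gcongr
          exact Nat.floor_le (by positivity)
      _ = (μ + A) / ζ ^ 2 * (q / Δ) := by
          field_simp
  rw [ENNReal.ofReal_add (by positivity) (by positivity), ENNReal.ofReal_add (by positivity)
    (by positivity)]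
  refine le_trans (measure_mono (t := {x | ¬ ∀ i, samplingTime ((nextPath Δ)^[i] x) Δ 1 ≠ ⊤} ∪
    ({x | ∃ k ≤ ⌊t⌋₊, A * √t ≤ |walk x k - k * μ|} ∪ {x | ∃ k ≤ ⌊β * t⌋₊, ζ * √t ≤
      |(walk x (⌊t⌋₊ - ⌊β * t⌋₊ + k) - walk x (⌊t⌋₊ - ⌊β * t⌋₊)) - k * μ|} ∪
    {x | ∃ k ≤ ⌊(μ + A) * t / Δ⌋₊, ζ * √t ≤
      |∑ i ∈ Finset.range k, overshoot ((nextPath Δ)^[i] x) Δ - k * e|})) ?_) ?_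
  · intro x hx
    by_contra hc
    simp only [Set.mem_union, Set.mem_ofPred_eq, not_or, not_not, not_exists, not_and,
      not_le] at hc hx
    exact hx ⟨hc.1, hc.2.1.1, hc.2.1.2, hc.2.2⟩
  · refine (measure_union_le _ _).trans ?_
    rw [h0, zero_add]
    refine (measure_union_le _ _).trans (add_le_add ((measure_union_le _ _).trans
      (add_le_add ?_ ?_)) ?_)
    · exact h1.trans (ENNReal.ofReal_le_ofReal e1)
    · exact h3.trans (ENNReal.ofReal_le_ofReal e3)
    · exact h4.trans (ENNReal.ofReal_le_ofReal e4)

/-- On a good path, the number `N` of samples and the last sampling time `T` are related to the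
fluctuation of the walk by time `t`. -/
theorem IsGood.count_estimate {μ e A β ζ Δ t : ℝ} {x : ℕ → ℝ} (h : IsGood μ e A β ζ Δ t x)
    (hμ : 0 < μ) (hA : 0 < A) (hΔ : 0 < Δ) (ht : 1 ≤ t) (hβ : β ≤ 1)
    (hβt : Δ + 2 * A * √t ≤ μ * (β * t - 1)) :
    (lastSamplingTime x Δ t : ℝ) ≤ ⌊t⌋₊ ∧
    (⌊t⌋₊ : ℝ) - lastSamplingTime x Δ t ≤ β * t ∧
    μ * (⌊t⌋₊ - lastSamplingTime x Δ t) ≤ Δ + 2 * ζ * √t ∧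
    |(samplingCount x Δ t * (Δ + e) - lastSamplingTime x Δ t * μ) -
      (walk x ⌊t⌋₊ - ⌊t⌋₊ * μ)| ≤ 3 * ζ * √t := by
  have ht0 : 0 ≤ t := by linarith
  obtain ⟨hT, hTt⟩ := samplingTime_samplingCount (x := x) hΔ ht0
  set N := samplingCount x Δ t with hN
  set T := lastSamplingTime x Δ t with hTdef
  set n := ⌊t⌋₊ with hn
  set L := ⌊β * t⌋₊ with hL
  obtain ⟨k, hk, -, hw⟩ := samplingTime_renewal h.finite N
  obtain rfl : T = k := by
    rw [hT] at hk
    exact_mod_cast hk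
  have hTn : T ≤ n := Nat.le_floor hTt
  have hTn' : (T : ℝ) ≤ n := by exact_mod_cast hTn
  have hnt : (n : ℝ) ≤ t := Nat.floor_le ht0
  have hlt : walk x n - walk x T < Δ := walk_sub_walk_lastSamplingTime_lt hΔ ht0 hTn hnt
  have hwT := abs_lt.1 (h.walk_bound T hTn)
  have hwn := abs_lt.1 (h.walk_bound n le_rfl)
  have hst : √t ≤ t := Real.sqrt_le_iff.2 ⟨ht0, by nlinarith⟩
  have hsum0 : 0 ≤ ∑ i ∈ Finset.range N, overshoot ((nextPath Δ)^[i] x) Δ :=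
    Finset.sum_nonneg fun i _ => overshoot_nonneg (h.finite i)
  -- Overshoots are nonnegative, so `N Δ ≤ S_T < T μ + A √t ≤ (μ + A) t`.
  have hNle : N ≤ ⌊(μ + A) * t / Δ⌋₊ := by
    refine Nat.le_floor ((le_div_iff₀ hΔ).2 ?_)
    have h1 := mul_le_mul_of_nonneg_right hTt hμ.le
    have h2 := mul_le_mul_of_nonneg_left hst hA.le
    linarith
  have hM := abs_lt.1 (h.overshoot_bound N hNle)
  have hgap : μ * ((n : ℝ) - T) < Δ + 2 * A * √t := by linarith
  -- The `-1` in `hβt` pays for the floor in `L`, so that `n - L ≤ T`.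
  have hgap' : (n : ℝ) - T < β * t - 1 := by
    by_contra hc
    push Not at hc
    linarith [mul_le_mul_of_nonneg_left hc hμ.le]
  have hLt : β * t < L + 1 := Nat.lt_floor_add_one _
  have hnT : n ≤ T + L := by
    have : (n : ℝ) < (T + L : ℕ) := by
      push_cast
      linarith
    exact_mod_cast this.le
  have hLn : L ≤ n := by
    refine Nat.floor_mono ?_
    nlinarith
  obtain ⟨j, hj⟩ := Nat.exists_eq_add_of_le (show n - L ≤ T by omega)
  have r1 := abs_lt.1 (h.recent_bound j (by omega))
  have r2 := abs_lt.1 (h.recent_bound L le_rfl)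
  rw [← hn, ← hL] at r1 r2
  rw [← hj] at r1
  rw [Nat.sub_add_cancel hLn] at r2
  have hjr : (T : ℝ) = (n - L : ℕ) + j := by exact_mod_cast hj
  have hnr : (n : ℝ) = (n - L : ℕ) + L := by
    rw [← Nat.cast_add, Nat.sub_add_cancel hLn]
  -- Both `T` and `n` lie in the window starting at `n - L`, so each is compared with that common
  -- origin.
  have hd : |(walk x T - T * μ) - (walk x n - n * μ)| ≤ 2 * ζ * √t := by
    have e1 : (walk x T - T * μ) - (walk x n - n * μ) =
        (walk x T - walk x (n - L) - j * μ) - (walk x n - walk x (n - L) - L * μ) := by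
      linear_combination (-μ) * hjr + μ * hnr
    rw [e1, abs_le]
    constructor <;> linarith
  have hd' := abs_le.1 hd
  refine ⟨hTn', by linarith, by linarith, ?_⟩
  rw [abs_le]
  constructor <;> linarith

/-! ### Deterministic estimates for the two estimators on good paths -/

theorem IsGood.abs_walk_sub_div_le {μ e A β ζ Δ t : ℝ} {x : ℕ → ℝ}
    (h : IsGood μ e A β ζ Δ t x) (ht : 0 < t) :
    |(walk x ⌊t⌋₊ - ⌊t⌋₊ * μ) / √t| ≤ A := by
  have hs : 0 < √t := Real.sqrt_pos.2 ht
  rw [abs_div, abs_of_pos hs, div_le_iff₀ hs]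
  exact (h.walk_bound _ le_rfl).le

theorem IsGood.muCheck_estimate {μ e A β ζ Δ t : ℝ} {x : ℕ → ℝ} (h : IsGood μ e A β ζ Δ t x)
    (hμ : 0 < μ) (hA : 0 < A) (hΔ : 0 < Δ) (ht : 1 ≤ t) (hβ : β ≤ 1)
    (hβt : Δ + 2 * A * √t ≤ μ * (β * t - 1)) :
    |√t * (muCheck x Δ t * (1 + e / Δ) - μ) - (walk x ⌊t⌋₊ - ⌊t⌋₊ * μ) / √t| ≤
      5 * ζ + (μ + Δ) / √t := by
  obtain ⟨h1, -, h3, h4⟩ := h.count_estimate hμ hA hΔ ht hβ hβt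
  have ht0 : 0 < t := by linarith
  have hs : 0 < √t := Real.sqrt_pos.2 ht0
  have hst : √t * √t = t := Real.mul_self_sqrt ht0.le
  have hnt : (⌊t⌋₊ : ℝ) ≤ t := Nat.floor_le ht0.le
  have hnt' : t < ⌊t⌋₊ + 1 := Nat.lt_floor_add_one t
  set W := walk x ⌊t⌋₊ - ⌊t⌋₊ * μ
  set N : ℝ := ((samplingCount x Δ t : ℕ) : ℝ) with hN
  set T : ℝ := ((lastSamplingTime x Δ t : ℕ) : ℝ)
  -- The term `μ (⌊t⌋₊ - T)` is the elapsed but unsampled time; its bound `Δ + 2 ζ √t` produces `Δ /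
  -- √t`.
  have e1 : √t * (muCheck x Δ t * (1 + e / Δ) - μ) - W / √t =
      ((N * (Δ + e) - T * μ - W) - μ * (⌊t⌋₊ - T) - μ * (t - ⌊t⌋₊)) / √t := by
    rw [muCheck, ← hN, eq_div_iff hs.ne', sub_mul, div_mul_cancel₀ _ hs.ne',
      show √t * (N * Δ / t * (1 + e / Δ) - μ) * √t = √t * √t * (N * Δ / t * (1 + e / Δ) - μ) by
        ring, hst]
    field_simp
    ring
  have e2 : 5 * ζ + (μ + Δ) / √t = (5 * ζ * √t + (μ + Δ)) / √t := by
    field_simp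
  rw [e1, e2, abs_div, abs_of_pos hs]
  refine div_le_div_of_nonneg_right ?_ hs.le
  have h4' := abs_le.1 h4
  have h5 : 0 ≤ μ * (⌊t⌋₊ - T) := mul_nonneg hμ.le (by linarith)
  have h6 : 0 ≤ μ * (t - ⌊t⌋₊) := mul_nonneg hμ.le (by linarith)
  have h7 : μ * (t - ⌊t⌋₊) ≤ μ * 1 := mul_le_mul_of_nonneg_left (by linarith) hμ.le
  have h8 : 0 ≤ 3 * ζ * √t := (abs_nonneg _).trans h4
  rw [abs_le]
  constructor <;> linarith

theorem IsGood.muHat_estimate {μ e A β ζ Δ t : ℝ} {x : ℕ → ℝ} (h : IsGood μ e A β ζ Δ t x)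
    (hμ : 0 < μ) (hA : 0 < A) (hΔ : 0 < Δ) (ht : 4 ≤ t) (hβ : β ≤ 1 / 4)
    (hβt : Δ + 2 * A * √t ≤ μ * (β * t - 1)) :
    |√t * (muHat x Δ t * (1 + e / Δ) - μ) - (walk x ⌊t⌋₊ - ⌊t⌋₊ * μ) / √t| ≤
      6 * ζ + 2 * A * β + 2 * A / t := by
  obtain ⟨h1, h2, -, h4⟩ := h.count_estimate hμ hA hΔ (by linarith) (by linarith) hβt
  have ht0 : 0 < t := by linarith
  have hs : 0 < √t := Real.sqrt_pos.2 ht0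
  have hst : √t * √t = t := Real.mul_self_sqrt ht0.le
  have hnt : (⌊t⌋₊ : ℝ) ≤ t := Nat.floor_le ht0.le
  have hnt' : t < ⌊t⌋₊ + 1 := Nat.lt_floor_add_one t
  have hW := h.abs_walk_sub_div_le ht0
  set W := walk x ⌊t⌋₊ - ⌊t⌋₊ * μ
  set N : ℝ := ((samplingCount x Δ t : ℕ) : ℝ) with hN
  set T : ℝ := ((lastSamplingTime x Δ t : ℕ) : ℝ) with hT
  -- From `T ≥ n - t / 4` and `n > t - 1 ≥ 3 t / 4`.
  have hT2 : t / 2 ≤ T := by nlinarith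
  have hT0 : 0 < T := by linarith
  -- Normalizing by `T` leaves `t - T` only as a relative factor on `W / √t`, so no term of order `Δ
  -- / √t` appears.
  have e1 : √t * (muHat x Δ t * (1 + e / Δ) - μ) - W / √t =
      (√t / T) * (N * (Δ + e) - T * μ - W) + (W / √t) * ((t - T) / T) := by
    have e0 : W / √t * (t / T) = √t / T * W := by
      rw [div_mul_div_comm, div_mul_eq_mul_div, div_eq_div_iff (by positivity) hT0.ne']
      linear_combination (-W * T) * hst
    rw [sub_div t T T, mul_sub (W / √t), e0, div_self hT0.ne', mul_one, muHat, ← hN, ← hT]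
    field_simp
    ring
  have b1 : |(√t / T) * (N * (Δ + e) - T * μ - W)| ≤ 6 * ζ := by
    rw [abs_mul, abs_of_pos (by positivity)]
    calc √t / T * |N * (Δ + e) - T * μ - W| ≤ √t / (t / 2) * (3 * ζ * √t) := by
          gcongr
      _ = 6 * ζ * (√t * √t) / t := by field_simp; ring
      _ = 6 * ζ := by rw [hst]; field_simp
  have b2 : |(W / √t) * ((t - T) / T)| ≤ 2 * A * β + 2 * A / t := by
    rw [abs_mul, abs_of_nonneg (a := (t - T) / T) (div_nonneg (by linarith) hT0.le)]
    calc |W / √t| * ((t - T) / T) ≤ A * ((β * t + 1) / (t / 2)) := by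
          gcongr
          · exact div_nonneg (by linarith) hT0.le
          · linarith
          · linarith
      _ = 2 * A * β + 2 * A / t := by field_simp
  rw [e1]
  exact (abs_add_le _ _).trans (by linarith)

/-- Replacing the mean overshoot `e` by the correction `ρ u`. -/
theorem abs_correct_sub_le {ρ : ℝ → ℝ} {μ e A Δ t u w z C c E : ℝ} (hμ : 0 < μ) (hΔ : 0 < Δ)
    (ht : 1 ≤ t) (hu : 0 ≤ u) (he : 0 ≤ e) (heE : e ≤ E) (hC : 0 ≤ C)
    (hρ : ∀ m, 0 < m → |ρ m - ρ μ| ≤ C * |m - μ|) (heρ : |e - ρ μ| ≤ c / Δ)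
    (hw : |w| ≤ A) (hz : z ≤ 1) (h : |√t * (u * (1 + e / Δ) - μ) - w| ≤ z) :
    |√t * (correct ρ Δ u - μ) - w| ≤
      z + (μ + A + 1) * C * (A + 1) / Δ +
        (μ + A + 1) * (C * (μ + A + 1) * E + c) * (√t / Δ ^ 2) := by
  have ht0 : 0 < t := by linarith
  have hs : 0 < √t := Real.sqrt_pos.2 ht0
  have hs1 : 1 ≤ √t := Real.one_le_sqrt.2 ht
  set B := μ + A + 1 with hB
  have hA0 : 0 ≤ A := (abs_nonneg w).trans hw
  have hB0 : 0 < B := by linarith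
  have hc0 : 0 ≤ c := by
    have := (abs_nonneg _).trans heρ
    by_contra hc
    push Not at hc
    exact absurd this (not_le.2 (div_neg_of_neg_of_pos hc hΔ))
  have hE0 : 0 ≤ E := he.trans heE
  have k1 : |u * (1 + e / Δ) - μ| ≤ (A + 1) / √t := by
    rw [le_div_iff₀ hs]
    have : |√t * (u * (1 + e / Δ) - μ)| ≤ A + 1 := by
      have := abs_add_le (√t * (u * (1 + e / Δ) - μ) - w) w
      rw [sub_add_cancel] at this
      linarith
    rwa [abs_mul, abs_of_pos hs, mul_comm] at this
  have hed : 0 ≤ e / Δ := div_nonneg he hΔ.le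
  have k2 : u * (1 + e / Δ) ≤ B := by
    have h1 : (A + 1) / √t ≤ A + 1 := div_le_self (by linarith) hs1
    linarith [(abs_le.1 k1).2]
  have k3 : u ≤ B := by nlinarith [mul_nonneg hu hed]
  -- `u` has a stochastic error of order `1/√t` and an uncorrected bias of order `1/Δ`.
  have k4 : |u - μ| ≤ (A + 1) / √t + B * E / Δ := by
    have h1 : u - μ = (u * (1 + e / Δ) - μ) - u * (e / Δ) := by ring
    have h2 : |u * (e / Δ)| ≤ B * E / Δ := by
      rw [abs_of_nonneg (mul_nonneg hu hed), mul_div_assoc]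
      gcongr
    rw [h1]
    exact (abs_sub _ _).trans (by linarith)
  have k5 : |√t * (u * (ρ u - e) / Δ)| ≤
      B * C * (A + 1) / Δ + B * (C * B * E + c) * (√t / Δ ^ 2) := by
    -- At `u = 0` the Lipschitz bound is unavailable, but the factor `u` kills the term.
    rcases hu.eq_or_lt with rfl | hu0
    · simp only [zero_mul, zero_div, mul_zero, abs_zero]
      positivity
    · have h1 : |ρ u - e| ≤ C * ((A + 1) / √t + B * E / Δ) + c / Δ := by
        have h2 := abs_sub_le (ρ u) (ρ μ) e
        rw [abs_sub_comm (ρ μ) e] at h2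
        have h3 := (hρ u hu0).trans (mul_le_mul_of_nonneg_left k4 hC)
        linarith
      rw [abs_mul, abs_div, abs_mul, abs_of_pos hs, abs_of_pos hΔ, abs_of_pos hu0]
      calc √t * (u * |ρ u - e| / Δ)
          ≤ √t * (B * (C * ((A + 1) / √t + B * E / Δ) + c / Δ) / Δ) := by gcongr
        _ = _ := by
          field_simp
          ring
  have e1 : √t * (correct ρ Δ u - μ) - w =
      (√t * (u * (1 + e / Δ) - μ) - w) + √t * (u * (ρ u - e) / Δ) := by
    rw [correct]
    ring
  rw [e1]
  exact (abs_add_le _ _).trans (by linarith)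

/-! ### The limit theorem on the space of paths -/

theorem iIndepFun_pathLaw (Q : Measure ℝ) [IsProbabilityMeasure Q] :
    iIndepFun (fun (k : ℕ) (x : ℕ → ℝ) => x k) (pathLaw Q) := by
  rw [iIndepFun_iff_map_fun_eq_infinitePi_map₀' fun i => (measurable_pi_apply i).aemeasurable]
  simp only [Measure.infinitePi_map_eval]
  exact Measure.map_id

theorem tendstoInDistribution_walk {Q : Measure ℝ} {P : Measure (ℕ → ℝ)}
    [IsProbabilityMeasure P] (hmp : ∀ k : ℕ, MeasurePreserving (fun x : ℕ → ℝ => x k) P Q)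
    (hind : iIndepFun (fun (k : ℕ) (x : ℕ → ℝ) => x k) P)
    (h2 : MemLp (fun u : ℝ => u) 2 Q) (hv : 0 < Var[id; Q]) {ι : Type*} {l : Filter ι}
    {t : ι → ℝ} (ht : Tendsto t l atTop) :
    TendstoInDistribution
      (fun i (x : ℕ → ℝ) => (walk x ⌊t i⌋₊ - ⌊t i⌋₊ * ∫ u, u ∂Q) / (√Var[id; Q] * √⌊t i⌋₊))
      l (fun z : ℝ => z) (fun _ => P) (gaussianReal 0 1) := by
  have hid : ∀ k : ℕ, IdentDistrib (fun x : ℕ → ℝ => x k) (fun x : ℕ → ℝ => x 0)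
      P P := fun k =>
    ⟨(hmp k).aemeasurable, (hmp 0).aemeasurable, by rw [(hmp k).map_eq, (hmp 0).map_eq]⟩
  have hvar : Var[fun x : ℕ → ℝ => x 0; P] = Var[id; Q] := by
    have := variance_map (X := id) aemeasurable_id (hmp 0).aemeasurable
    rw [(hmp 0).map_eq] at this
    exact this.symm
  have hmean : ∫ x : ℕ → ℝ, x 0 ∂P = ∫ u, u ∂Q := by
    have := integral_map (f := fun u : ℝ => u) (hmp 0).aemeasurable
      measurable_id.aestronglyMeasurable
    rw [(hmp 0).map_eq] at this
    exact this.symm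
  have hs : 0 < √Var[id; Q] := Real.sqrt_pos.2 hv
  have hY : HasLaw (fun z : ℝ => √Var[id; Q] * z)
      (gaussianReal 0 Var[fun x : ℕ → ℝ => x 0; P].toNNReal) (gaussianReal 0 1) := by
    refine ⟨by fun_prop, ?_⟩
    rw [gaussianReal_map_const_mul, hvar]
    simp only [mul_zero, mul_one]
    congr 1
    ext
    simp [Real.sq_sqrt hv.le, hv.le]
  have hclt := tendstoInDistribution_inv_sqrt_mul_sum_sub
    (X := fun (k : ℕ) (x : ℕ → ℝ) => x k) hY (h2.comp_measurePreserving (hmp 0))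
    hind hid
  have h3 := hclt.continuous_comp (g := fun z => z / √Var[id; Q]) (by fun_prop)
  have h4 : TendstoInDistribution
      (fun (n : ℕ) (x : ℕ → ℝ) => (walk x n - n * ∫ u, u ∂Q) / (√Var[id; Q] * √n))
      atTop (fun z : ℝ => z) (fun _ => P) (gaussianReal 0 1) := by
    refine h3.congr (fun n => Eventually.of_forall fun x => ?_) (Eventually.of_forall fun z => ?_)
    · simp only [Function.comp, hmean, walk]
      rw [div_eq_mul_inv, div_eq_mul_inv, mul_inv]
      ring
    · simp only [Function.comp]
      field_simp
  have hn : Tendsto (fun i => ⌊t i⌋₊) l atTop := tendsto_nat_floor_atTop.comp ht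
  exact ⟨fun i => h4.forall_aemeasurable _, h4.aemeasurable_limit, h4.tendsto.comp hn⟩

theorem tendstoInMeasure_zero_of_eventually_le {E ι : Type*} [MeasurableSpace E] {P : Measure E}
    {l : Filter ι} {R : ι → E → ℝ}
    (h : ∀ ε κ : ℝ, 0 < ε → 0 < κ → ∀ᶠ i in l, P {x | ε ≤ |R i x|} ≤ ENNReal.ofReal κ) :
    TendstoInMeasure P R l 0 := by
  rw [tendstoInMeasure_iff_norm]
  intro ε hε
  rw [ENNReal.tendsto_nhds_zero]
  intro κ hκ
  rcases eq_or_ne κ ⊤ with rfl | hκt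
  · simp
  filter_upwards [h ε κ.toReal hε (ENNReal.toReal_pos hκ.ne' hκt)] with i hi
  rw [ENNReal.ofReal_toReal hκt] at hi
  simpa using hi

/-- Replacing the normalization by `√n` with that by `√t`. -/
theorem abs_normalized_sub_le {y W σ t n A z : ℝ} (hσ : 0 < σ) (ht : 0 < t) (hn : t / 2 ≤ n)
    (hnt : n ≤ t) (hnt' : t < n + 1) (hW : |W / √t| ≤ A) (h : |√t * y - W / √t| ≤ z) :
    |y / (σ / √t) - W / (σ * √n)| ≤ (z + 2 * A / t) / σ := by
  have hn0 : 0 < n := by linarith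
  have hsn : 0 < √n := Real.sqrt_pos.2 hn0
  have hst : 0 < √t := Real.sqrt_pos.2 ht
  have hA : 0 ≤ A := (abs_nonneg _).trans hW
  have hratio : |1 - √t / √n| ≤ 2 / t := by
    have h1 : 1 ≤ √t / √n := (one_le_div hsn).2 (Real.sqrt_le_sqrt hnt)
    have h3 : √t / √n ≤ t / n := by
      have h5 : (√t / √n) ^ 2 = t / n := by
        rw [div_pow, Real.sq_sqrt ht.le, Real.sq_sqrt hn0.le]
      nlinarith
    have h4 : t / n - 1 ≤ 2 / t := by
      rw [div_sub_one hn0.ne', div_le_div_iff₀ hn0 ht]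
      nlinarith
    rw [abs_sub_comm, abs_of_nonneg (by linarith)]
    linarith
  have hfin : y / (σ / √t) - W / (σ * √n) =
      ((√t * y - W / √t) + W / √t * (1 - √t / √n)) / σ := by
    field_simp
    ring
  have hprod : |W / √t * (1 - √t / √n)| ≤ 2 * A / t := by
    rw [abs_mul]
    calc |W / √t| * |1 - √t / √n| ≤ A * (2 / t) := by gcongr
      _ = 2 * A / t := by ring
  rw [hfin, abs_div, abs_of_pos hσ]
  refine div_le_div_of_nonneg_right ?_ hσ.le
  exact (abs_add_le _ _).trans (by linarith)

/-- An estimator which satisfies the uncorrected estimate on good paths is asymptotically normal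
after the correction. -/
theorem tendstoInDistribution_correct {Q : Measure ℝ} [IsProbabilityMeasure Q]
    (h2 : MemLp (fun u : ℝ => u) 2 Q) (hμ : 0 < ∫ u, u ∂Q) (hv : 0 < Var[id; Q])
    {ρ : ℝ → ℝ} {C c : ℝ} (hC : 0 ≤ C)
    (hρ : ∀ m, 0 < m → |ρ m - ρ (∫ u, u ∂Q)| ≤ C * |m - ∫ u, u ∂Q|)
    (heρ : ∀ᶠ D in atTop, |∫ y, overshoot y D ∂(pathLaw Q) - ρ (∫ u, u ∂Q)| ≤ c / D)
    {ι : Type*} {l : Filter ι} [l.IsCountablyGenerated] {Δ t : ι → ℝ} (hΔ : ∀ i, 0 < Δ i)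
    (ht : Tendsto t l atTop) (hΔt : Tendsto Δ l atTop)
    (hlow : Tendsto (fun i => √(t i) / Δ i ^ 2) l (𝓝 0))
    {u : ι → (ℕ → ℝ) → ℝ} (hu : ∀ i x, 0 ≤ u i x)
    (hmeas : ∀ i, Measurable fun x => correct ρ (Δ i) (u i x))
    (hest : ∀ A β ζ : ℝ, 0 < A → 0 < β → β ≤ 1 / 4 → 0 < ζ →
      ∃ b : ι → ℝ, Tendsto b l (𝓝 0) ∧ ∀ᶠ i in l, ∀ x,
        IsGood (∫ u, u ∂Q) (∫ y, overshoot y (Δ i) ∂(pathLaw Q)) A β ζ (Δ i) (t i) x →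
        |√(t i) * (u i x * (1 + (∫ y, overshoot y (Δ i) ∂(pathLaw Q)) / Δ i) - ∫ u, u ∂Q) -
          (walk x ⌊t i⌋₊ - ⌊t i⌋₊ * ∫ u, u ∂Q) / √(t i)| ≤ 6 * ζ + 2 * A * β + b i) :
    TendstoInDistribution
      (fun i x => (correct ρ (Δ i) (u i x) - ∫ u, u ∂Q) / (√Var[id; Q] / √(t i)))
      l (fun z : ℝ => z) (fun _ => pathLaw Q) (gaussianReal 0 1) := by
  set μ := ∫ u, u ∂Q with hμdef
  set v := Var[id; Q] with hvdef
  set σ := √v with hσ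
  have hσ0 : 0 < σ := Real.sqrt_pos.2 hv
  have hint : Integrable (fun u : ℝ => u) Q := h2.integrable one_le_two
  -- Slutsky: it remains to show that the difference from the normalized walk tends to `0` in
  -- probability.
  refine tendstoInDistribution_of_tendstoInMeasure_sub _ _ (tendstoInDistribution_walk
    (measurePreserving_eval_infinitePi fun _ : ℕ => Q) (iIndepFun_pathLaw Q) h2 hv ht)
    (tendstoInMeasure_zero_of_eventually_le fun ε κ hε hκ => ?_)
    fun i => (((hmeas i).sub_const _).div_const _).aemeasurable
  rw [← hvdef, ← hμdef, ← hσ]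
  -- The order of choice matters: `A` from `κ`, `ζ` from `ε`, then `β` small in terms of both. Each
  -- of the three failure probabilities gets `κ / 3`; the bounds by `1 / 4` ensure `z ≤ 1` in
  -- `abs_correct_sub_le`.
  obtain ⟨A, hA, hAκ⟩ : ∃ A : ℝ, 0 < A ∧ v / A ^ 2 ≤ κ / 3 := by
    refine ⟨√(3 * v / κ), by positivity, ?_⟩
    rw [Real.sq_sqrt (by positivity)]
    field_simp
    exact le_rfl
  obtain ⟨ζ, hζ, hζε, hζ1⟩ : ∃ ζ : ℝ, 0 < ζ ∧ 6 * ζ ≤ ε * σ / 8 ∧ 6 * ζ ≤ 1 / 4 := by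
    refine ⟨min (ε * σ / 48) (1 / 24), by positivity, ?_, ?_⟩
    · linarith [min_le_left (ε * σ / 48) (1 / 24)]
    · linarith [min_le_right (ε * σ / 48) (1 / 24)]
  obtain ⟨β, hβ, hβ4, hβκ, hβε, hβ1⟩ : ∃ β : ℝ, 0 < β ∧ β ≤ 1 / 4 ∧ β * v / ζ ^ 2 ≤ κ / 3 ∧
      2 * A * β ≤ ε * σ / 8 ∧ 2 * A * β ≤ 1 / 4 := by
    have hlim : ∀ a : ℝ, Tendsto (fun β : ℝ => a * β) (𝓝[>] 0) (𝓝 0) := fun a => by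
      have : Tendsto (fun β : ℝ => a * β) (𝓝 0) (𝓝 (a * 0)) := tendsto_id.const_mul a
      rw [mul_zero] at this
      exact this.mono_left nhdsWithin_le_nhds
    have h1 := (hlim 1).eventually_le_const (show (0 : ℝ) < 1 / 4 by norm_num)
    have h3 := (hlim (v / ζ ^ 2)).eventually_le_const (show (0 : ℝ) < κ / 3 by positivity)
    have h4 := (hlim (2 * A)).eventually_le_const (show (0 : ℝ) < ε * σ / 8 by positivity)
    have h5 := (hlim (2 * A)).eventually_le_const (show (0 : ℝ) < 1 / 4 by norm_num)
    obtain ⟨β, h0, h1, h3, h4, h5⟩ :=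
      ((eventually_mem_nhdsWithin (a := (0 : ℝ)) (s := Set.Ioi 0)).and
        (h1.and (h3.and (h4.and h5)))).exists
    refine ⟨β, h0, by linarith, ?_, h4, h5⟩
    rw [mul_comm, mul_div_right_comm]
    exact h3
  obtain ⟨b, hb, hbest⟩ := hest A β ζ hA hβ hβ4 hζ
  have hinvt : Tendsto (fun i => (t i)⁻¹) l (𝓝 0) := tendsto_inv_atTop_zero.comp ht
  have hinvΔ : Tendsto (fun i => (Δ i)⁻¹) l (𝓝 0) := tendsto_inv_atTop_zero.comp hΔt
  set E := |ρ μ| + |c| with hE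
  set k₁ := (μ + A + 1) * C * (A + 1) with hk₁
  set k₂ := (μ + A + 1) * (C * (μ + A + 1) * E + c) with hk₂
  have hrem : Tendsto (fun i => b i + k₁ * (Δ i)⁻¹ + k₂ * (√(t i) / Δ i ^ 2) + 2 * A * (t i)⁻¹) l
      (𝓝 0) := by
    have := ((hb.add (hinvΔ.const_mul k₁)).add (hlow.const_mul k₂)).add (hinvt.const_mul (2 * A))
    simpa using this
  have hη : ∀ᶠ i in l, (μ + A) / ζ ^ 2 *
      ((∫ y, overshoot y (Δ i) ^ 2 ∂(pathLaw Q)) / Δ i) ≤ κ / 3 := by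
    set a := (μ + A) / ζ ^ 2 with ha
    have ha0 : 0 < a := by positivity
    obtain ⟨K, hK, hKΔ⟩ := exists_integral_overshoot_sq_le Q h2 hμ
      (c := κ / (6 * a)) (by positivity)
    have : Tendsto (fun i => a * K * (Δ i)⁻¹) l (𝓝 0) := by
      simpa using hinvΔ.const_mul (a * K)
    filter_upwards [this.eventually_le_const (show (0 : ℝ) < κ / 6 by positivity)] with i hi
    have hΔi := hΔ i
    calc a * ((∫ y, overshoot y (Δ i) ^ 2 ∂(pathLaw Q)) / Δ i)
        ≤ a * ((K + κ / (6 * a) * Δ i) / Δ i) := by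
          gcongr
          exact (hKΔ _ (hΔ i)).2
      _ = a * K * (Δ i)⁻¹ + κ / 6 := by
          field_simp
      _ ≤ κ / 3 := by linarith
  filter_upwards [hη, hbest, ht.eventually_ge_atTop 4, hΔt.eventually_ge_atTop 1,
    hΔt.eventually heρ, hrem.eventually_le_const (show (0 : ℝ) < ε * σ / 4 by positivity),
    hb.eventually_le_const (show (0 : ℝ) < 1 / 4 by norm_num)] with i hηi hbi hti hΔi hei hri hb1
  have ht0 : 0 < t i := by linarith
  refine (measure_mono fun x hx => ?_).trans
    ((measure_not_isGood_le h2 hμ hA hβ hζ (hΔ i) ht0).trans (ENNReal.ofReal_le_ofReal ?_))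
  · by_contra hgood
    simp only [Set.mem_ofPred_eq, not_not] at hgood
    have hest1 := hbi x hgood
    have hW := hgood.abs_walk_sub_div_le ht0
    set e := ∫ y, overshoot y (Δ i) ∂(pathLaw Q) with he
    have he0 : 0 ≤ e := integral_nonneg_of_ae (by
      filter_upwards [ae_samplingTime_one_ne_top hint hμ (hΔ i)] with y hy
      exact overshoot_nonneg hy)
    have heE : e ≤ E := by
      have h1 : c / Δ i ≤ |c| :=
        (div_le_div_of_nonneg_right (le_abs_self c) (hΔ i).le).trans
          (div_le_self (abs_nonneg c) hΔi)
      have h3 := (abs_le.1 hei).2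
      have h4 := le_abs_self (ρ μ)
      linarith
    have hcor := abs_correct_sub_le hμ (hΔ i) (by linarith) (hu i x) he0 heE hC hρ hei hW
      (by linarith) hest1
    set W := walk x ⌊t i⌋₊ - ⌊t i⌋₊ * μ with hWdef
    have hnt : (⌊t i⌋₊ : ℝ) ≤ t i := Nat.floor_le ht0.le
    have hnt' : t i < ⌊t i⌋₊ + 1 := Nat.lt_floor_add_one _
    have hn2 : t i / 2 ≤ (⌊t i⌋₊ : ℝ) := by linarith
    have hn0 : 0 < (⌊t i⌋₊ : ℝ) := by linarith
    have hx' : ε ≤ |(correct ρ (Δ i) (u i x) - μ) / (σ / √(t i)) - W / (σ * √⌊t i⌋₊)| := hx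
    have hfin := hx'.trans (abs_normalized_sub_le hσ0 ht0 hn2 hnt hnt' hW hcor)
    rw [le_div_iff₀ hσ0, ← hk₁, ← hk₂, div_eq_mul_inv k₁, div_eq_mul_inv (2 * A)] at hfin
    -- The errors add up to at most `ε σ / 8 + ε σ / 8 + ε σ / 4 = ε σ / 2`, contradicting `hfin`.
    have hpos : 0 < ε * σ := by positivity
    linarith
  · linarith

/-! ### Measurability of the estimators and transfer to the given probability space -/

/-- The estimator factors through a countable discrete space, so `ρ` may be arbitrary. -/
theorem measurable_correct_muCheck (ρ : ℝ → ℝ) {Δ t : ℝ} (hΔ : 0 < Δ) (ht : 0 ≤ t) :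
    Measurable fun x => correct ρ Δ (muCheck x Δ t) :=
  (Measurable.of_discrete (f := fun n : ℕ => correct ρ Δ (n * Δ / t))).comp
    (measurable_samplingCount hΔ ht)

theorem measurable_correct_muHat (ρ : ℝ → ℝ) {Δ t : ℝ} (hΔ : 0 < Δ) (ht : 0 ≤ t) :
    Measurable fun x => correct ρ Δ (muHat x Δ t) :=
  (Measurable.of_discrete (f := fun p : ℕ × ℕ => correct ρ Δ (p.1 * Δ / p.2))).comp
    ((measurable_samplingCount hΔ ht).prodMk (measurable_lastSamplingTime hΔ ht))

theorem tendstoInDistribution_comp_hasLaw {Ω E Ω' ι : Type*} [MeasurableSpace Ω]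
    [MeasurableSpace E] [MeasurableSpace Ω'] {Pr : Measure Ω} [IsProbabilityMeasure Pr]
    {P : Measure E} [IsProbabilityMeasure P] {P' : Measure Ω'} [IsProbabilityMeasure P']
    {S : Ω → E} (hS : HasLaw S P Pr) {l : Filter ι} {F : ι → E → ℝ} {Z : Ω' → ℝ}
    (h : TendstoInDistribution F l Z (fun _ => P) P') :
    TendstoInDistribution (fun i ω => F i (S ω)) l Z (fun _ => Pr) P' := by
  have hF : ∀ i, AEMeasurable (F i) (Pr.map S) := fun i => by
    rw [hS.map_eq]
    exact h.forall_aemeasurable i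
  refine ⟨fun i => (hF i).comp_aemeasurable hS.aemeasurable, h.aemeasurable_limit, ?_⟩
  refine h.tendsto.congr fun i => Subtype.ext ?_
  change P.map (F i) = Pr.map (F i ∘ S)
  rw [← AEMeasurable.map_map_of_aemeasurable (hF i) hS.aemeasurable, hS.map_eq]

/-- Zero variance would concentrate `Q` at its mean, which lies in the lattice spanned by that
positive mean. -/
theorem variance_pos_of_isNonLattice {Q : Measure ℝ} [IsProbabilityMeasure Q]
    (h2 : MemLp (fun u : ℝ => u) 2 Q) (hμ : 0 < ∫ u, u ∂Q) (hnl : IsNonLattice Q) :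
    0 < Var[id; Q] := by
  refine (variance_nonneg _ _).lt_of_ne' fun h0 => hnl _ hμ ?_
  filter_upwards [ae_eq_integral_of_variance_eq_zero (X := id) h2 h0] with u hu
  exact ⟨1, by simpa using hu⟩

/-- The estimates for `muCheck` and `muHat` hold on good paths once `Δ / t` is small. -/
theorem eventually_add_sqrt_le {ι : Type*} {l : Filter ι} {Δ t : ι → ℝ}
    (ht : Tendsto t l atTop) (hΔ : Δ =o[l] t) {μ A β : ℝ} (hμ : 0 < μ) (hβ : 0 < β) :
    ∀ᶠ i in l, Δ i + 2 * A * √(t i) ≤ μ * (β * t i - 1) := by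
  have hs : Tendsto (fun i => (√(t i))⁻¹) l (𝓝 0) :=
    tendsto_inv_atTop_zero.comp (Real.tendsto_sqrt_atTop.comp ht)
  have hi : Tendsto (fun i => (t i)⁻¹) l (𝓝 0) := tendsto_inv_atTop_zero.comp ht
  have hlim : Tendsto (fun i => Δ i / t i + 2 * A * (√(t i))⁻¹ + μ * (t i)⁻¹) l (𝓝 0) := by
    simpa using (hΔ.tendsto_div_nhds_zero.add (hs.const_mul (2 * A))).add (hi.const_mul μ)
  filter_upwards [hlim.eventually_le_const (mul_pos hμ hβ), ht.eventually_gt_atTop 0] with i h h0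
  have h1 := mul_le_mul_of_nonneg_right h h0.le
  have h2 : (Δ i / t i + 2 * A * (√(t i))⁻¹ + μ * (t i)⁻¹) * t i =
      Δ i + 2 * A * √(t i) + μ := by
    have h3 : (√(t i))⁻¹ * t i = √(t i) := by
      rw [inv_mul_eq_div, Real.div_sqrt]
    rw [add_mul, add_mul, div_mul_cancel₀ _ h0.ne', mul_assoc (2 * A), h3, mul_assoc μ,
      inv_mul_cancel₀ h0.ne', mul_one]
  linarith

end LowRate

end

open LowRate in
theorem mainTheorem7
    -- the family of laws of `X`, parametrized by the mean `m > 0`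
    (P : ℝ → Measure ℝ)
    (hP : ∀ m : ℝ, 0 < m →
      IsProbabilityMeasure (P m) ∧ MemLp (fun x : ℝ => x) 2 (P m) ∧ ∫ x, x ∂(P m) = m)
    -- the true mean and the observations
    (μ : ℝ) (hμ : 0 < μ)
    {Ω : Type*} [MeasurableSpace Ω] (Pr : Measure Ω) [IsProbabilityMeasure Pr]
    (X : ℕ → Ω → ℝ) (hXlaw : ∀ i, HasLaw (X i) (P μ) Pr) (hXindep : iIndepFun X Pr)
    (hnl : LowRate.IsNonLattice (P μ))
    (hA1 : ∃ r : ℝ, 2 ≤ r ∧ Integrable (fun ω => |X 0 ω| ^ (r + 1)) Pr)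
    (hA2 : ∃ r : ℝ, 2 ≤ r ∧
      (fun Δ : ℝ => LowRate.meanOvershoot Pr X Δ - LowRate.limitingOvershoot (P μ))
        =O[atTop] fun Δ : ℝ => Δ ^ (-(r - 1)))
    (hA3 : ∃ C : ℝ≥0,
      LipschitzOnWith C (fun m => LowRate.limitingOvershoot (P m)) (Set.Ioi 0))
    -- an arbitrary way in which the thresholds and the time horizon vary
    {ι : Type*} (l : Filter ι) [l.IsCountablyGenerated] (Δ t : ι → ℝ)
    (hΔ : ∀ i, 0 < Δ i) (ht : ∀ i, 0 < t i)
    (ht_top : Tendsto t l atTop)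
    (hδ_top : Tendsto (fun i => LowRate.samplingPeriod Pr X (Δ i)) l atTop)
    (hδ_low : (fun i => t i ^ (1 / 4 : ℝ)) =o[l]
      fun i => LowRate.samplingPeriod Pr X (Δ i)) :
    ((fun i => LowRate.samplingPeriod Pr X (Δ i)) =o[l] (fun i => √(t i)) →
      TendstoInDistribution
        (fun i ω =>
          (LowRate.correct (fun m => LowRate.limitingOvershoot (P m)) (Δ i)
              (LowRate.muCheck (fun j => X j ω) (Δ i) (t i)) - μ) /
            (√(Var[X 0; Pr]) / √(t i)))
        l (fun z : ℝ => z) (fun _ => Pr) (gaussianReal 0 1)) ∧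
    ((fun i => LowRate.samplingPeriod Pr X (Δ i)) =o[l] t →
      TendstoInDistribution
        (fun i ω =>
          (LowRate.correct (fun m => LowRate.limitingOvershoot (P m)) (Δ i)
              (LowRate.muHat (fun j => X j ω) (Δ i) (t i)) - μ) /
            (√(Var[X 0; Pr]) / √(t i)))
        l (fun z : ℝ => z) (fun _ => Pr) (gaussianReal 0 1)) := by
  obtain ⟨hQ, h2, hmean⟩ := hP μ hμ
  set Q := P μ with hQdef
  set ρ : ℝ → ℝ := fun m => limitingOvershoot (P m) with hρdef
  have hint : Integrable (fun u : ℝ => u) Q := h2.integrable one_le_two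
  have hμ' : 0 < ∫ u, u ∂Q := by rwa [hmean]
  have hpath : HasLaw (fun ω i => X i ω) (pathLaw Q) Pr :=
    hXindep.hasLaw_infinitePi hXlaw (aemeasurable_pi_iff.2 fun i => (hXlaw i).aemeasurable)
  have hv : 0 < Var[id; Q] := variance_pos_of_isNonLattice h2 hμ' hnl
  have hvar : Var[X 0; Pr] = Var[id; Q] := by
    have := variance_map (X := id) aemeasurable_id (hXlaw 0).aemeasurable
    rw [(hXlaw 0).map_eq] at this
    exact this.symm
  have hcomp : ∀ f : (ℕ → ℝ) → ℝ, Measurable f →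
      ∫ ω, f (fun i => X i ω) ∂Pr = ∫ x, f x ∂(pathLaw Q) := by
    intro f hf
    have := integral_map (f := f) hpath.aemeasurable hf.aestronglyMeasurable
    rw [hpath.map_eq] at this
    exact this.symm
  have hper : ∀ D, samplingPeriod Pr X D =
      ∫ x, ((samplingTime x D 1).toNat : ℝ) ∂(pathLaw Q) := fun D =>
    hcomp _ (measurable_from_nat.comp (measurable_samplingTime_toNat D 1))
  have hos : ∀ D, meanOvershoot Pr X D = ∫ x, overshoot x D ∂(pathLaw Q) := fun D =>
    hcomp _ (measurable_overshoot D)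
  obtain ⟨K, hK, hKδ⟩ := exists_integral_samplingTime_one_le Q hint hμ'
  simp only [← hper, hmean] at hKδ
  have hδlow : ∀ D, 0 < D → D ≤ samplingPeriod Pr X D * ∫ u, |u| ∂Q := fun D hD => by
    rw [hper]
    exact le_integral_samplingTime_one_mul hint hμ' hD
  have hδ0 : ∀ D, 0 ≤ samplingPeriod Pr X D := fun D =>
    integral_nonneg fun _ => Nat.cast_nonneg _
  have hΔ_top : Tendsto Δ l atTop := by
    refine tendsto_atTop_mono (f := fun i => μ / 2 * samplingPeriod Pr X (Δ i) - K) (fun i => ?_)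
      (tendsto_atTop_add_const_right _ _ (hδ_top.const_mul_atTop (by positivity)))
    have := hKδ _ (hΔ i)
    rw [le_div_iff₀ hμ] at this
    linarith
  have hδΔ : (fun i => samplingPeriod Pr X (Δ i)) =O[l] Δ := by
    refine IsBigO.of_bound (2 * (1 + K) / μ) ?_
    filter_upwards [hΔ_top.eventually_ge_atTop 1] with i hi
    rw [Real.norm_of_nonneg (hδ0 _), Real.norm_of_nonneg (hΔ i).le]
    refine (hKδ _ (hΔ i)).trans ?_
    rw [div_mul_eq_mul_div]
    refine div_le_div_of_nonneg_right ?_ hμ.le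
    nlinarith
  have hΔδ : Δ =O[l] fun i => samplingPeriod Pr X (Δ i) := by
    refine IsBigO.of_bound (∫ u, |u| ∂Q) (Eventually.of_forall fun i => ?_)
    rw [Real.norm_of_nonneg (hδ0 _), Real.norm_of_nonneg (hΔ i).le, mul_comm]
    exact hδlow _ (hΔ i)
  have hlow : Tendsto (fun i => √(t i) / Δ i ^ 2) l (𝓝 0) := by
    -- Squaring `t^{1/4} = o(Δ)` gives `√t = o(Δ²)`.
    have h1 := ((hδ_low.trans_isBigO hδΔ).pow two_pos).tendsto_div_nhds_zero
    refine h1.congr fun i => ?_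
    rw [Real.sqrt_eq_rpow, ← Real.rpow_natCast (t i ^ (1 / 4 : ℝ)), ← Real.rpow_mul (ht i).le]
    norm_num
  obtain ⟨C, hC⟩ := hA3
  have hρ : ∀ m, 0 < m → |ρ m - ρ (∫ u, u ∂Q)| ≤ C * |m - ∫ u, u ∂Q| := fun m hm => by
    rw [hmean]
    exact hC.dist_le_mul m hm μ hμ
  obtain ⟨r, hr, hOr⟩ := hA2
  obtain ⟨c, hc⟩ := hOr.bound
  have heρ : ∀ᶠ D in atTop, |∫ y, overshoot y D ∂(pathLaw Q) - ρ (∫ u, u ∂Q)| ≤ |c| / D := by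
    filter_upwards [hc, eventually_ge_atTop 1] with D hD hD1
    rw [hmean, ← hos]
    -- Since `r ≥ 2`, the rate in (A2) is at least as fast as `1/Δ`.
    have h1 : D ^ (-(r - 1)) ≤ D⁻¹ := by
      rw [← Real.rpow_neg_one]
      exact Real.rpow_le_rpow_of_exponent_le hD1 (by linarith)
    have h0 : 0 ≤ D ^ (-(r - 1)) := by positivity
    rw [Real.norm_of_nonneg h0, Real.norm_eq_abs] at hD
    calc _ ≤ c * D ^ (-(r - 1)) := hD
      _ ≤ |c| * D⁻¹ := mul_le_mul (le_abs_self c) h1 h0 (abs_nonneg c)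
      _ = |c| / D := (div_eq_mul_inv _ _).symm
  have hst : Tendsto (fun i => √(t i)) l atTop := Real.tendsto_sqrt_atTop.comp ht_top
  have hsqrt : (fun i => √(t i)) =o[l] t := by
    refine (isLittleO_iff_tendsto' ?_).2 ?_
    · exact Eventually.of_forall fun i h => absurd h (ht i).ne'
    · refine (tendsto_inv_atTop_zero.comp hst).congr fun i => ?_
      rw [Real.sqrt_div_self]
      rfl
  rw [hvar]
  constructor
  · intro hδ
    have hΔs : Δ =o[l] fun i => √(t i) := hΔδ.trans_isLittleO hδ
    have hΔt : Δ =o[l] t := hΔs.trans hsqrt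
    have := tendstoInDistribution_correct h2 hμ' hv C.2 hρ heρ hΔ ht_top hΔ_top hlow
      (u := fun i x => muCheck x (Δ i) (t i))
      (fun i x => div_nonneg (mul_nonneg (Nat.cast_nonneg _) (hΔ i).le) (ht i).le)
      (fun i => measurable_correct_muCheck ρ (hΔ i) (ht i).le)
      (fun A β ζ hA hβ hβ4 hζ => by
        -- This remainder vanishes because `Δ = o(√t)`, the one place where (i) needs more than `δ =
        -- o(t)`.
        refine ⟨fun i => (μ + Δ i) / √(t i), ?_, ?_⟩
        · have h1 := (hst.const_div_atTop μ).add hΔs.tendsto_div_nhds_zero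
          rw [add_zero] at h1
          exact h1.congr fun i => (add_div _ _ _).symm
        · filter_upwards [ht_top.eventually_ge_atTop 1,
            eventually_add_sqrt_le (A := A) ht_top hΔt hμ hβ] with i h1 h3 x hx
          rw [hmean] at hx ⊢
          refine (hx.muCheck_estimate hμ hA (hΔ i) h1 (by linarith) h3).trans ?_
          have : 0 ≤ 2 * A * β := by positivity
          linarith)
    rw [hmean] at this
    exact tendstoInDistribution_comp_hasLaw hpath this
  · intro hδ
    have hΔt : Δ =o[l] t := hΔδ.trans_isLittleO hδ
    have := tendstoInDistribution_correct h2 hμ' hv C.2 hρ heρ hΔ ht_top hΔ_top hlow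
      (u := fun i x => muHat x (Δ i) (t i))
      (fun i x => div_nonneg (mul_nonneg (Nat.cast_nonneg _) (hΔ i).le) (Nat.cast_nonneg _))
      (fun i => measurable_correct_muHat ρ (hΔ i) (ht i).le)
      (fun A β ζ hA hβ hβ4 hζ => by
        refine ⟨fun i => 2 * A / t i, ht_top.const_div_atTop _, ?_⟩
        filter_upwards [ht_top.eventually_ge_atTop 4,
          eventually_add_sqrt_le (A := A) ht_top hΔt hμ hβ] with i h1 h3 x hx
        rw [hmean] at hx ⊢
        exact hx.muHat_estimate hμ hA (hΔ i) h1 hβ4 h3)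
    rw [hmean] at this
    exact tendstoInDistribution_comp_hasLaw hpath this
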